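/- Fix an integer $p\ge 2$. A (plane) $p$-hypermap is a finite connected map (multiple edges and loops allowed) on the sphere, up to orientation-preserving homeomorphism, whose faces are shaded dark or light so that adjacent faces have different shades and every dark face has degree $p$. There are two ways to orient all edges: with the light faces on their left ("light-left") or on their right ("light-right"); once one is chosen, $e^-$ and $e^+$ denote the origin and the end of an edge $e$, paths follow the orientation of the edges, and $\vec d(v,v')$ is the smallest length of a path from $v$ to $v'$. An edge $e$ is leaving the vertex $v$ if $\vec d(v,e^+)=\vec d(v,e^-)+1$. The corner preceding an edge $e$ is the corner delimited by $e$ and the edge before $e$ in the oriented contour of the light face incident to $e$; $c^+$ denotes the vertex of a corner $c$. The lightest geodesic from a corner $c_0$ of a light face to a vertex $v'$ is the shortest path from $c_0^+$ to $v'$ obtained by choosing at each step, among the edges going out of the current vertex and decreasing $\vec d(\cdot,v')$ by $1$, the one that comes first when turning around that vertex from the corner $c_0$ (first step) or from the edge just used (later steps), in the direction "incoming edge, light face". Let $\mathcal H$ be the set of quadruples $(\mathcal O,\mathfrak m,c,e)$ where $\mathcal O$ is one of the two orientations, $\mathfrak m$ is a $p$-hypermap, $c$ is a corner of a light face of $\mathfrak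 m$, and $e$ is an edge of $\mathfrak m$ leaving $c^+$ in the orientation $\mathcal O$. Define $\Phi(\mathcal O,\mathfrak m,c,e)=(\tilde{\mathcal O},\tilde{\mathfrak m},\tilde c,\tilde e)$ as follows. Let $\tilde{\mathcal O}$ be the orientation opposite to $\mathcal O$, and use it from now on. Let $c_e$ be the corner preceding $e$ and let $\gamma=(e_1,\dots,e_k)$ be the lightest geodesic from $c_e$ to $c^+$ (its first edge is $e_1=e$). Slit the sphere along $\gamma$, entering from $c_e$ and exiting through $c$, so that each $e_i$ is doubled into a side $\ell_i$ incident to a light face and a side $d_i$ incident to a dark face; then sew $\ell_{i+1}$ onto $d_i$ for $1\le i\le k-1$. The unmatched $\ell_1$ is now a dangling edge: remove it, and let $\tilde c$ be the resulting corner. Let $\tilde e$ be the edge given by the unmatched $d_k$, and $\tilde{\mathfrak m}$ the resulting map. Then $\Phi$ maps $\mathcal H$ into $\mathcal H$ and is an involution. The same holds, for every $r\ge0$, for $p$-hypermaps with $r$ light faces numbered $1,\dots,r$, each bearing one marked corner, where a marked corner is seen as a dangling half-edge that splits the corner into two corners to be distinguished, where $c_e$ and $\tilde c$ are the corners adjacent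 to $e$ and to the removed $\ell_1$, respectively, and where the marks and numbers are carried along by the construction. -/

import Mathlib

/-!
Plane maps with dark and light faces are encoded, as is standard for maps on oriented surfaces, by
the permutations describing the contours of their faces. A map with edge set `E` whose light
corners carry marks (dangling half-edges) indexed by `ι` is given by

* `light`, a permutation of `E ⊕ ι`: it sends an edge or a mark to the edge or mark that comes next
  along the contour of the incident light face;
* `dark`, a permutation of `E`: it sends an edge to the next edge along the contour of the incident
  dark face.

All edges are oriented with their light face on the same side, and both contours are followed in
the direction of the edges. Every edge has exactly one light side and one dark side, so that
adjacent faces automatically have different shades. Taking `ι` empty gives maps without marks.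

A corner of a light face is identified with the element `x : E ⊕ ι` that *follows* it in
the contour of the face. A mark splits the corner in which it lies into two corners.
-/

noncomputable section

namespace Hyper

/-- The two ways of orienting all the edges: light faces on the left, or on the right. -/
inductive EdgeOrientation
  | lightLeft
  | lightRight

/-- The reverse orientation. -/
def EdgeOrientation.reverse : EdgeOrientation → EdgeOrientation
  | .lightLeft => .lightRight
  | .lightRight => .lightLeft

/-- Contours of the light faces (with the marks they carry) and of the dark faces of a map with
edge set `E` and set of marks `ι`, followed in the direction of the edges. -/
structure ShadedMap (E ι : Type) where
  light : Equiv.Perm (E ⊕ ι)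
  dark : Equiv.Perm E

namespace ShadedMap

variable {E ι : Type}

/-- The dark contours, extended by fixing the marks. -/
def darkExt (m : ShadedMap E ι) : Equiv.Perm (E ⊕ ι) :=
  Equiv.sumCongr m.dark (Equiv.refl ι)

/-- Turning around a vertex in the direction "incoming edge, light face": from an outgoing edge,
cross its dark side to get to an incoming edge, then cross the light side of the latter,
to get to the next outgoing edge, or to a mark if there is one in the light corner crossed. From a
mark, move on to what follows it in its light face. -/
def turn (m : ShadedMap E ι) : Equiv.Perm (E ⊕ ι) :=
  m.light * m.darkExt⁻¹

/-- The vertices: what is met while turning around a vertex is a cycle of `turn`. -/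
def Vertex (m : ShadedMap E ι) : Type :=
  Quotient (Equiv.Perm.SameCycle.setoid m.turn)

/-- The light faces: cycles of the light contour. -/
def LightFace (m : ShadedMap E ι) : Type :=
  Quotient (Equiv.Perm.SameCycle.setoid m.light)

/-- The dark faces: cycles of the dark contour. -/
def DarkFace (m : ShadedMap E ι) : Type :=
  Quotient (Equiv.Perm.SameCycle.setoid m.dark)

/-- The vertex incident to the light corner preceding `x`. -/
def vertexAt (m : ShadedMap E ι) (x : E ⊕ ι) : m.Vertex :=
  Quotient.mk (Equiv.Perm.SameCycle.setoid m.turn) x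

/-- The origin of an edge. -/
def origin (m : ShadedMap E ι) (e : E) : m.Vertex :=
  m.vertexAt (Sum.inl e)

/-- The end of an edge: the vertex of the light corner following it. -/
def terminus (m : ShadedMap E ι) (e : E) : m.Vertex :=
  m.vertexAt (m.light (Sum.inl e))

/-- `m` is a plane `p`-hypermap: it is connected, its dark faces have degree `p`, and it lies on the
sphere (by Euler's formula). -/
structure IsHypermap (m : ShadedMap E ι) (p : ℕ) : Prop where
  connected : ∀ x y : E ⊕ ι, ∃ g ∈ Subgroup.closure {m.light, m.darkExt}, g x = y
  dark_degree : ∀ e : E, Function.minimalPeriod m.dark e = p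
  spherical : Nat.card m.Vertex + (Nat.card m.LightFace + Nat.card m.DarkFace) = Nat.card E + 2

/-- Every light face carries exactly one mark. -/
def IsMarked (m : ShadedMap E ι) : Prop :=
  ∀ x : E ⊕ ι, ∃! i : ι, m.light.SameCycle x (Sum.inr i)

/-- `γ` is a path from `v` to `w`, following the orientation of the edges. -/
def IsPath (m : ShadedMap E ι) : m.Vertex → List E → m.Vertex → Prop
  | v, [], w => v = w
  | v, e :: γ, w => m.origin e = v ∧ m.IsPath (m.terminus e) γ w

/-- The directed distance: the smallest length of a path from `v` to `w`. (In a
`p`-hypermap there always is such a path.) -/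
def dist (m : ShadedMap E ι) (v w : m.Vertex) : ℕ :=
  sInf {k | ∃ γ : List E, m.IsPath v γ w ∧ γ.length = k}

/-- `e` is leaving `v`. -/
def IsLeaving (m : ShadedMap E ι) (v : m.Vertex) (e : E) : Prop :=
  m.dist v (m.terminus e) = m.dist v (m.origin e) + 1

/-- `e` goes one step closer to `w`. -/
def IsCloser (m : ShadedMap E ι) (w : m.Vertex) (e : E) : Prop :=
  m.dist (m.terminus e) w + 1 = m.dist (m.origin e) w

/-- Entering a vertex at the light corner preceding `x`, the first outgoing edge that goes closer
to `w`, while turning around the vertex in the direction "incoming edge, light face". -/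
def firstCloser (m : ShadedMap E ι) (w : m.Vertex) (x : E ⊕ ι) : Option E :=
  open Classical in
  if h : ∃ i : ℕ, ∃ e : E, (m.turn ^ i) x = Sum.inl e ∧ m.IsCloser w e then
    some (Nat.find_spec h).choose
  else none

/-- The first `k` edges of the lightest geodesic to `w` starting from the corner preceding `x`. -/
def lightestFrom (m : ShadedMap E ι) (w : m.Vertex) : ℕ → E ⊕ ι → List E
  | 0, _ => []
  | k + 1, x =>
    match m.firstCloser w x with
    | none => []
    | some e => e :: m.lightestFrom w k (m.light (Sum.inl e))

/-- The lightest geodesic to `w` starting from the light corner preceding `x`. -/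
def lightestGeodesic (m : ShadedMap E ι) (x : E ⊕ ι) (w : m.Vertex) : List E :=
  m.lightestFrom w (m.dist (m.vertexAt x) w) x

/-- The same map, with all its edges reversed: contours are followed backward. -/
def reverse (m : ShadedMap E ι) : ShadedMap E ι where
  light := m.light⁻¹
  dark := m.dark⁻¹

/-- Passage between the light-left convention and the orientation `O` (in both directions). -/
def inOrientation (m : ShadedMap E ι) : EdgeOrientation → ShadedMap E ι
  | .lightLeft => m
  | .lightRight => m.reverse

/-- Passage between the light-left convention and the orientation `O` (in both directions) for a
light corner: the corner preceding `x` in `m` follows `m.light⁻¹ x` in `m`,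
and thus precedes `m.light⁻¹ x` in `m.reverse`. -/
def cornerInOrientation (m : ShadedMap E ι) (x : E ⊕ ι) : EdgeOrientation → E ⊕ ι
  | .lightLeft => x
  | .lightRight => m.light⁻¹ x

section SlitSlideSew

variable [DecidableEq E] [DecidableEq ι]

/-- The light contour from which the side `e` is deleted (and becomes a fixed point). -/
def deleteSide (l : Equiv.Perm (E ⊕ ι)) (e : E) : Equiv.Perm (E ⊕ ι) :=
  Equiv.swap (Sum.inl e) (l (Sum.inl e)) * l

/-- The light contour in which a side `e`, assumed fixed, is inserted in the corner preceding `x`. -/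
def insertSide (l : Equiv.Perm (E ⊕ ι)) (e : E) (x : E ⊕ ι) : Equiv.Perm (E ⊕ ι) :=
  Equiv.swap (Sum.inl e) x * l

/-- The light contour, once the map has been slit along a path with first edge `e₁` and last edge
`eₖ`, entering from the corner preceding `e₁` and exiting through the corner preceding `x`, once it
has been slid by one unit, and once the dangling edge has been removed.

The light sides are `ℓ₁, …, ℓₖ` along the path. After sliding, `ℓ₁` is not matched
and is adjacent to its own other side in the contour of its face: this dangling edge is deleted.
The dark side `dₖ` is not matched either, and its other side becomes incident to the face of the
exit corner, where it is inserted, between the two elements that delimit this corner. As the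
name `e₁` is not used any more for a light side, it is given to this new light side. -/
def slidLight (m : ShadedMap E ι) (e₁ : E) (x : E ⊕ ι) : Equiv.Perm (E ⊕ ι) :=
  insertSide (deleteSide m.light e₁) e₁ x

/-- The matching of dark sides with light sides after sliding along `γ = (e₁, …, eₖ)`: the dark side
of `eᵢ` gets the light side of `eᵢ₊₁`, the dark side of `eₖ` gets the new light side (named
`e₁`), while nothing changes for the other edges and for the marks. -/
def matching (γ : List E) : Equiv.Perm (E ⊕ ι) :=
  (γ.map Sum.inl).formPerm

/-- Slit the map along the path `e₁ :: γ` from the corner preceding `e₁` to the corner preceding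
`x`, slide by one unit, sew, and remove the dangling edge. The edges of the result are named after
their dark sides, so that the dark contours do not change. -/
def slitSlideSew (m : ShadedMap E ι) (e₁ : E) (γ : List E) (x : E ⊕ ι) : ShadedMap E ι where
  light := (matching (e₁ :: γ))⁻¹ * slidLight m e₁ x * matching (e₁ :: γ)
  dark := m.dark

/-- The corner of `slitSlideSew m e₁ γ x` left by the removal of the dangling edge, that is,
the corner following the element that used to come just before `ℓ₁` in its light contour. -/
def newCorner (m : ShadedMap E ι) (e₁ : E) (γ : List E) (x : E ⊕ ι) : E ⊕ ι :=
  (matching (e₁ :: γ))⁻¹ (slidLight m e₁ x (m.light⁻¹ (Sum.inl e₁)))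

end SlitSlideSew

end ShadedMap

/-- A map given with an orientation, a corner of a light face and an edge. The contours of
the map, and the element following the corner, are those for the light-left orientation, whatever
the orientation `orient` is. -/
structure Config (E ι : Type) where
  orient : EdgeOrientation
  map : ShadedMap E ι
  corner : E ⊕ ι
  edge : E

namespace Config

variable {E ι : Type}

/-- The map is a `p`-hypermap, and the edge is leaving the vertex incident to the corner, in
the given orientation. -/
def IsAdmissible (p : ℕ) (q : Config E ι) : Prop :=
  q.map.IsHypermap p ∧
    (q.map.inOrientation q.orient).IsLeaving
      ((q.map.inOrientation q.orient).vertexAt (q.map.cornerInOrientation q.corner q.orient))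
      q.edge

/-- Slit-slide-sew along `γ`, from the corner preceding the first edge of `γ` to the corner
preceding `x`, on a map `m` seen in the orientation `O`. The distinguished corner of the result is
the one left by the dangling edge and its distinguished edge is the one of the unmatched
dark side of the final edge of `γ`. (The case of the empty path, treated arbitrarily, does not occur
for admissible data.) -/
def ofSlide [DecidableEq E] [DecidableEq ι] (O : EdgeOrientation) (m : ShadedMap E ι)
    (x : E ⊕ ι) (e : E) : List E → Config E ι
  | [] => ⟨O, m.inOrientation O, m.cornerInOrientation x O, e⟩
  | e₁ :: γ =>
    { orient := O
      map := (m.slitSlideSew e₁ γ x).inOrientation O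
      corner := (m.slitSlideSew e₁ γ x).cornerInOrientation (m.newCorner e₁ γ x) O
      edge := (e₁ :: γ).getLast (List.cons_ne_nil e₁ γ) }

/-- Reverse the orientation, then slit, slide and sew along the lightest geodesic from the corner
preceding the distinguished edge to the vertex of the distinguished corner. -/
def slide [DecidableEq E] [DecidableEq ι] (q : Config E ι) : Config E ι :=
  let O := q.orient.reverse
  let m := q.map.inOrientation O
  let x := q.map.cornerInOrientation q.corner O
  ofSlide O m x q.edge (m.lightestGeodesic (Sum.inl q.edge) (m.vertexAt x))

end Config

/-! ### Renaming the edges -/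

section Relabel

variable {E E' E'' ι : Type}

/-- The renaming of edges and marks induced by a renaming of the edges. -/
def ren (ι : Type) (f : E ≃ E') : E ⊕ ι ≃ E' ⊕ ι := Equiv.sumCongr f (Equiv.refl ι)

/-- Renaming the edges of a map; the marks keep their names. -/
def ShadedMap.relabel (f : E ≃ E') (m : ShadedMap E ι) : ShadedMap E' ι where
  light := (ren ι f).permCongr m.light
  dark := f.permCongr m.dark

/-- Renaming the edges of a configuration. -/
def Config.relabel (f : E ≃ E') (q : Config E ι) : Config E' ι where
  orient := q.orient
  map := q.map.relabel f
  corner := ren ι f q.corner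
  edge := f q.edge

theorem Config.relabel_refl (q : Config E ι) : q.relabel (Equiv.refl E) = q := by
  obtain ⟨O, ⟨l, d⟩, c, e⟩ := q
  simp only [Config.relabel, ShadedMap.relabel, ren, Equiv.sumCongr_refl, Equiv.refl_apply]
  rfl

theorem Config.relabel_trans (f : E ≃ E') (g : E' ≃ E'') (q : Config E ι) :
    (q.relabel f).relabel g = q.relabel (f.trans g) := by
  obtain ⟨O, ⟨l, d⟩, c, e⟩ := q
  simp only [Config.relabel, ShadedMap.relabel, Config.mk.injEq, ShadedMap.mk.injEq, true_and]
  refine ⟨⟨?_, ?_⟩, ?_, rfl⟩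
  · ext x; rcases x with x | x <;> simp [ren]
  · ext x; simp
  · rcases c with x | x <;> simp [ren]

namespace ShadedMap

variable (f : E ≃ E') (m : ShadedMap E ι)

@[simp] theorem ren_inl (e : E) : ren ι f (Sum.inl e) = Sum.inl (f e) := rfl

theorem relabel_light (x : E ⊕ ι) : (m.relabel f).light (ren ι f x) = ren ι f (m.light x) := by
  simp [relabel]

theorem relabel_light_inv (x : E ⊕ ι) :
    (m.relabel f).light⁻¹ (ren ι f x) = ren ι f (m.light⁻¹ x) := by
  rw [Equiv.Perm.inv_eq_iff_eq, relabel_light]; simp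

theorem relabel_turn : (m.relabel f).turn = (ren ι f).permCongr m.turn := by
  have h : (m.relabel f).darkExt = (ren ι f).permCongr m.darkExt := by
    ext x; rcases x with x | x <;> simp [darkExt, relabel, ren]
  rw [turn, turn, h, Equiv.permCongr_mul]
  rfl

theorem relabel_turn_pow (i : ℕ) (x : E ⊕ ι) :
    ((m.relabel f).turn ^ i) (ren ι f x) = ren ι f ((m.turn ^ i) x) := by
  induction i with
  | zero => simp
  | succ i ih => rw [pow_succ', pow_succ', Equiv.Perm.mul_apply, ih, relabel_turn]; simp

theorem relabel_turn_zpow (i : ℤ) (x : E ⊕ ι) :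
    ((m.relabel f).turn ^ i) (ren ι f x) = ren ι f ((m.turn ^ i) x) := by
  rcases i with i | i
  · simpa using m.relabel_turn_pow f i x
  · rw [zpow_negSucc, zpow_negSucc, Equiv.Perm.inv_eq_iff_eq, relabel_turn_pow]; simp

/-- The bijection between vertices induced by a renaming of the edges. -/
def relabelVertex : m.Vertex ≃ (m.relabel f).Vertex :=
  Quotient.congr (ren ι f) fun x y => by
    change (∃ i : ℤ, _) ↔ (∃ i : ℤ, _)
    simp only [relabel_turn_zpow, EmbeddingLike.apply_eq_iff_eq]

theorem relabel_vertexAt (x : E ⊕ ι) :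
    (m.relabel f).vertexAt (ren ι f x) = m.relabelVertex f (m.vertexAt x) := rfl

theorem relabel_origin (e : E) :
    (m.relabel f).origin (f e) = m.relabelVertex f (m.origin e) := rfl

theorem relabel_terminus (e : E) :
    (m.relabel f).terminus (f e) = m.relabelVertex f (m.terminus e) := by
  rw [terminus, terminus, ← relabel_vertexAt, ← relabel_light]; rfl

theorem relabel_isPath (γ : List E) (v w : m.Vertex) :
    (m.relabel f).IsPath (m.relabelVertex f v) (γ.map f) (m.relabelVertex f w) ↔
      m.IsPath v γ w := by
  induction γ generalizing v with
  | nil => simp [IsPath]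
  | cons e γ ih => simp [IsPath, relabel_origin, relabel_terminus, ih]

theorem relabel_dist (v w : m.Vertex) :
    (m.relabel f).dist (m.relabelVertex f v) (m.relabelVertex f w) = m.dist v w := by
  unfold dist
  congr 1
  ext k
  constructor
  · rintro ⟨γ, h, hk⟩
    refine ⟨γ.map f.symm, ?_, by simpa using hk⟩
    rw [← relabel_isPath f]
    simpa using h
  · rintro ⟨γ, h, hk⟩
    exact ⟨γ.map f, (m.relabel_isPath f γ v w).2 h, by simpa using hk⟩

theorem relabel_isCloser (w : m.Vertex) (e : E) :
    (m.relabel f).IsCloser (m.relabelVertex f w) (f e) ↔ m.IsCloser w e := by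
  simp only [IsCloser, relabel_origin, relabel_terminus, relabel_dist]

theorem relabel_firstCloser (w : m.Vertex) (x : E ⊕ ι) :
    (m.relabel f).firstCloser (m.relabelVertex f w) (ren ι f x) =
      (m.firstCloser w x).map f := by
  classical
  have key : ∀ i : ℕ, ∀ e : E, ((m.relabel f).turn ^ i) (ren ι f x) = Sum.inl (f e) ∧
      (m.relabel f).IsCloser (m.relabelVertex f w) (f e) ↔
        (m.turn ^ i) x = Sum.inl e ∧ m.IsCloser w e := by
    intro i e
    rw [relabel_turn_pow, relabel_isCloser, ← ren_inl, EmbeddingLike.apply_eq_iff_eq]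
  have key' : ∀ i : ℕ, (∃ e : E', ((m.relabel f).turn ^ i) (ren ι f x) = Sum.inl e ∧
      (m.relabel f).IsCloser (m.relabelVertex f w) e) ↔
        ∃ e : E, (m.turn ^ i) x = Sum.inl e ∧ m.IsCloser w e := by
    intro i
    rw [f.surjective.exists (p := fun e => ((m.relabel f).turn ^ i) (ren ι f x) = Sum.inl e ∧
      (m.relabel f).IsCloser (m.relabelVertex f w) e)]
    simp only [key]
  unfold firstCloser
  by_cases h : ∃ i : ℕ, ∃ e : E, (m.turn ^ i) x = Sum.inl e ∧ m.IsCloser w e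
  · have h' := (exists_congr key').2 h
    rw [dif_pos h, dif_pos h', Option.map_some, Option.some.injEq]
    have hfind : Nat.find h' = Nat.find h := Nat.find_congr' (fun {i} => key' i)
    have h1 := (Nat.find_spec h').choose_spec.1
    have h2 := (Nat.find_spec h).choose_spec.1
    have h3 : ((m.relabel f).turn ^ Nat.find h) (ren ι f x) =
        Sum.inl (f (Nat.find_spec h).choose) :=
      (m.relabel_turn_pow f _ x).trans (congrArg (ren ι f) h2)
    have h4 : ((m.relabel f).turn ^ Nat.find h') (ren ι f x) =
        ((m.relabel f).turn ^ Nat.find h) (ren ι f x) := by rw [hfind]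
    exact Sum.inl_injective (h1.symm.trans (h4.trans h3))
  · have h' := fun hh => h ((exists_congr key').1 hh)
    rw [dif_neg h, dif_neg h', Option.map_none]

theorem relabel_lightestFrom (w : m.Vertex) (k : ℕ) (x : E ⊕ ι) :
    (m.relabel f).lightestFrom (m.relabelVertex f w) k (ren ι f x) =
      (m.lightestFrom w k x).map f := by
  induction k generalizing x with
  | zero => rfl
  | succ k ih =>
    simp only [lightestFrom, relabel_firstCloser]
    cases m.firstCloser w x with
    | none => rfl
    | some e =>
      simp only [Option.map_some, List.map_cons]
      rw [← ih, ← relabel_light, ren_inl]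

theorem relabel_lightestGeodesic (x : E ⊕ ι) (w : m.Vertex) :
    (m.relabel f).lightestGeodesic (ren ι f x) (m.relabelVertex f w) =
      (m.lightestGeodesic x w).map f := by
  rw [lightestGeodesic, relabel_vertexAt, relabel_dist, relabel_lightestFrom]; rfl

theorem relabel_inOrientation (O : EdgeOrientation) :
    (m.relabel f).inOrientation O = (m.inOrientation O).relabel f := by
  cases O
  · rfl
  · simp only [inOrientation, reverse, relabel, mk.injEq]
    constructor <;> rfl

theorem relabel_cornerInOrientation (x : E ⊕ ι) (O : EdgeOrientation) :
    (m.relabel f).cornerInOrientation (ren ι f x) O =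
      ren ι f (m.cornerInOrientation x O) := by
  cases O
  · rfl
  · exact m.relabel_light_inv f x

variable [DecidableEq E] [DecidableEq E'] [DecidableEq ι]

theorem permCongr_swap {α β : Type} [DecidableEq α] [DecidableEq β] (g : α ≃ β) (a b : α) :
    g.permCongr (Equiv.swap a b) = Equiv.swap (g a) (g b) :=
  Equiv.symm_trans_swap_trans a b g

theorem relabel_slidLight (e₁ : E) (x : E ⊕ ι) :
    (m.relabel f).slidLight (f e₁) (ren ι f x) =
      (ren ι f).permCongr (m.slidLight e₁ x) := by
  simp only [slidLight, insertSide, deleteSide, ← ren_inl, relabel_light, Equiv.permCongr_mul,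
    permCongr_swap]
  rfl

theorem relabel_matching (γ : List E) :
    matching (ι := ι) (γ.map f) = (ren ι f).permCongr (matching γ) := by
  unfold matching
  induction γ with
  | nil => ext x; simp
  | cons a γ ih =>
    cases γ with
    | nil => ext x; simp
    | cons b γ =>
      simp only [List.map_cons, List.formPerm_cons_cons, Equiv.permCongr_mul, permCongr_swap,
        ren_inl] at ih ⊢
      rw [ih]

theorem permCongr_inv {α β : Type} (g : α ≃ β) (s : Equiv.Perm α) :
    (g.permCongr s)⁻¹ = g.permCongr s⁻¹ := rfl

theorem relabel_slitSlideSew (e₁ : E) (γ : List E) (x : E ⊕ ι) :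
    (m.relabel f).slitSlideSew (f e₁) (γ.map f) (ren ι f x) =
      (m.slitSlideSew e₁ γ x).relabel f := by
  simp only [slitSlideSew, relabel_slidLight, ← List.map_cons, relabel_matching, permCongr_inv,
    ← Equiv.permCongr_mul]
  rfl

theorem relabel_newCorner (e₁ : E) (γ : List E) (x : E ⊕ ι) :
    (m.relabel f).newCorner (f e₁) (γ.map f) (ren ι f x) =
      ren ι f (m.newCorner e₁ γ x) := by
  simp only [newCorner, relabel_slidLight, ← List.map_cons, relabel_matching, permCongr_inv,
    ← ren_inl, relabel_light_inv]
  simp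

end ShadedMap

theorem Config.relabel_ofSlide [DecidableEq E] [DecidableEq E'] [DecidableEq ι] (f : E ≃ E')
    (O : EdgeOrientation) (m : ShadedMap E ι) (x : E ⊕ ι) (e : E) (γ : List E) :
    Config.ofSlide O (m.relabel f) (ren ι f x) (f e) (γ.map f) =
      (Config.ofSlide O m x e γ).relabel f := by
  cases γ with
  | nil =>
    simp only [List.map_nil, ofSlide, ShadedMap.relabel_inOrientation,
      ShadedMap.relabel_cornerInOrientation]
    rfl
  | cons e₁ γ =>
    simp only [List.map_cons, ofSlide, ShadedMap.relabel_slitSlideSew,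
      ShadedMap.relabel_newCorner, ShadedMap.relabel_inOrientation,
      ShadedMap.relabel_cornerInOrientation, Config.relabel, Config.mk.injEq, true_and]
    simp only [← List.map_cons, List.getLast_map]

/-- The construction does not depend on the names of the edges. -/
theorem Config.relabel_slide [DecidableEq E] [DecidableEq E'] [DecidableEq ι] (f : E ≃ E')
    (q : Config E ι) : (q.relabel f).slide = q.slide.relabel f := by
  have h : ∀ (m m' : ShadedMap E' ι) (x : E' ⊕ ι) (O : EdgeOrientation) (e : E'), m = m' →
      ofSlide O m x e (m.lightestGeodesic (Sum.inl e) (m.vertexAt x)) =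
        ofSlide O m' x e (m'.lightestGeodesic (Sum.inl e) (m'.vertexAt x)) := by
    rintro m m' x O e rfl
    rfl
  obtain ⟨O, m, c, e⟩ := q
  simp only [Config.slide, Config.relabel]
  rw [h _ _ _ _ _ (m.relabel_inOrientation f O.reverse), ShadedMap.relabel_cornerInOrientation,
    ← ShadedMap.ren_inl, ShadedMap.relabel_vertexAt, ShadedMap.relabel_lightestGeodesic,
    Config.relabel_ofSlide]
  rfl

end Relabel

/-! ### Maps considered up to homeomorphism -/

/-- Two configurations with `r` numbered marks and finitely many edges are the same, up to
orientation-preserving homeomorphism of the sphere, if they only differ by the names of the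
edges. -/
def configSetoid (r : ℕ) : Setoid (Σ n : ℕ, Config (Fin n) (Fin r)) where
  r a b := ∃ f : Fin a.1 ≃ Fin b.1, a.2.relabel f = b.2
  iseqv :=
    { refl := fun a => ⟨Equiv.refl _, a.2.relabel_refl⟩
      symm := by
        rintro a b ⟨f, h⟩
        exact ⟨f.symm, by rw [← h, Config.relabel_trans, Equiv.self_trans_symm,
          Config.relabel_refl]⟩
      trans := by
        rintro a b c ⟨f, h⟩ ⟨g, h'⟩
        exact ⟨f.trans g, by rw [← Config.relabel_trans, h, h']⟩ }

/-- Quadruples (orientation, map with `r` numbered marks, corner of a light face, edge),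
where maps are considered up to orientation-preserving homeomorphism. -/
def Quadruple (r : ℕ) : Type := Quotient (configSetoid r)

/-- The mapping `Φ` on quadruples. -/
def Phi {r : ℕ} : Quadruple r → Quadruple r :=
  Quotient.map' (s₁ := configSetoid r) (s₂ := configSetoid r)
    (fun a => ⟨a.1, a.2.slide⟩) (by
      rintro a b ⟨f, h⟩
      exact ⟨f, by rw [← h, Config.relabel_slide]⟩)

/-- The quadruples formed by an orientation, a plane `p`-hypermap without marks, a distinguished
corner of a light face, and a distinguished edge leaving the vertex of this corner. -/
def H (p : ℕ) : Set (Quadruple 0) :=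
  {q | ∃ (n : ℕ) (a : Config (Fin n) (Fin 0)),
    q = Quotient.mk (configSetoid 0) ⟨n, a⟩ ∧ a.IsAdmissible p}

/-- The same set for `p`-hypermaps with exactly `r` light faces, numbered, each bearing a
marked corner. A marked corner counts for two corners to be distinguished. -/
def markedH (p r : ℕ) : Set (Quadruple r) :=
  {q | ∃ (n : ℕ) (a : Config (Fin n) (Fin r)),
    q = Quotient.mk (configSetoid r) ⟨n, a⟩ ∧ a.IsAdmissible p ∧ a.map.IsMarked}

end Hyper

end

/-! In the orientation opposite to that of the configuration, the distinguished edge is no longer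
leaving the vertex of the corner `x`: it goes closer to it. Its lightest geodesic thus has edges `c
0, …, c (k - 1)`, whose origins are at distances `k, …, 1` from the exit vertex. Three facts carry
the proof.

The result is again a hypermap. Sliding along a path amounts to sliding along its edges one at a
time (`slitSlideSew_cons`). For one edge with distinct ends, the light contour and the rotation
around the vertices are multiplied by the same two transpositions. On light faces, the first
isolates a side and the second inserts it elsewhere; on vertices, the first merges the two ends and
the second splits the result. Cycle counts, hence Euler's formula, are preserved.

The path remains a geodesic and, backward, it is lightest. Slitting cuts each vertex after the first
into a light copy and a dark copy; sliding glues each light copy to the dark copy of the previous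
vertex. Hence `potential`, that is `k` minus the old distance to the exit, lowered by one beside the
path, is a function of the new vertices (`potential_slid_turn`). As the geodesic is lightest, no
edge starting beside it goes closer to the exit. So the potential grows by at most one along a new
edge, and not at all along an edge whose dark side ends beside the path (`potential_slid_light_le`).
It bounds the distance from the new corner from below, with equality on the path. The edges met
before those of the reversed path, when turning in the reversed map, are of the latter kind, so they
are not eligible (`slid_reverse_isLightest`).

Finally, sliding along the reversed path undoes the first slide, by an identity between permutations
(`slid_reverse_slid`, `slidCorner_slid_reverse`). -/

noncomputable section

namespace Hyper

/-! ### Cycles of permutations -/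

section Cycles

open Equiv Equiv.Perm

variable {α : Type*}

/-- The number of cycles of a permutation, fixed points included. -/
def cycleCount (σ : Perm α) : ℕ := Nat.card (Quotient (SameCycle.setoid σ))

theorem rel_zpow_of_rel_apply {r : α → α → Prop} (hr : Equivalence r) {σ : Perm α}
    (h : ∀ y, r y (σ y)) (n : ℤ) (y : α) : r y ((σ ^ n) y) := by
  induction n with
  | zero => exact hr.refl y
  | succ n ih =>
    rw [add_comm, zpow_add, zpow_one, mul_apply]
    exact hr.trans ih (h _)
  | pred n ih =>
    rw [show (-(n : ℤ) - 1) = -1 + -n by ring, zpow_add, mul_apply, zpow_neg_one]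
    refine hr.trans ih (hr.symm ?_)
    simpa using h (σ⁻¹ ((σ ^ (-(n : ℤ))) y))

/-- Cycles are the classes of the smallest equivalence relation containing the pairs `(y, σ y)`.
This gives invariance along cycles from a check on single steps. -/
theorem rel_of_sameCycle {r : α → α → Prop} (hr : Equivalence r) {σ : Perm α}
    (h : ∀ y, r y (σ y)) {y z : α} (hs : σ.SameCycle y z) : r y z := by
  obtain ⟨n, rfl⟩ := hs
  exact rel_zpow_of_rel_apply hr h n y

theorem sameCycle_equivalence (σ : Perm α) : Equivalence σ.SameCycle :=
  ⟨SameCycle.refl σ, SameCycle.symm, SameCycle.trans⟩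

theorem pow_eq_pow_of_eq_on {σ π : Perm α} {y : α} {n : ℕ}
    (h : ∀ j < n, π ((σ ^ j) y) = (σ ^ (j + 1)) y) {j : ℕ} (hj : j ≤ n) :
    (π ^ j) y = (σ ^ j) y := by
  induction j with
  | zero => rfl
  | succ j ih => rw [pow_succ', mul_apply, ih (by omega), h j (by omega)]

theorem exists_minimal_pow [Finite α] {σ : Perm α} {a b : α} (h : σ.SameCycle a b) :
    ∃ n : ℕ, (σ ^ n) a = b ∧ ∀ j < n, (σ ^ j) a ≠ b := by
  classical
  obtain ⟨i, hi⟩ := h.exists_nat_pow_eq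
  have hex : ∃ i : ℕ, (σ ^ i) a = b := ⟨i, hi⟩
  exact ⟨Nat.find hex, Nat.find_spec hex, fun j hj => Nat.find_min hex hj⟩

theorem cycleCount_congr {β : Type*} {σ : Perm α} {π : Perm β} (f : α ≃ β)
    (h : ∀ y z, σ.SameCycle y z ↔ π.SameCycle (f y) (f z)) : cycleCount σ = cycleCount π :=
  Nat.card_congr (Quotient.congr f h)

variable [DecidableEq α]

/-- The orbit of `a` follows `σ` without meeting `b`, until the step that would return to `a`, which
is redirected to `b`. -/
theorem sameCycle_swap_mul_of_not_sameCycle [Finite α] {σ : Perm α} {a b : α}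
    (h : ¬ σ.SameCycle a b) : (swap a b * σ).SameCycle a b := by
  obtain ⟨n, hn, hmin⟩ := exists_minimal_pow (σ := σ) (a := σ a) (b := a)
    (sameCycle_apply_left.2 (SameCycle.refl σ a))
  refine ⟨(n + 1 : ℕ), ?_⟩
  have hpow : ∀ j, (σ ^ (j + 1)) a = (σ ^ j) (σ a) := fun j => by rw [pow_succ, mul_apply]
  have key : ((swap a b * σ) ^ n) a = (σ ^ n) a := by
    refine pow_eq_pow_of_eq_on (n := n) (fun j hj => ?_) le_rfl
    rw [mul_apply, ← mul_apply σ, ← pow_succ', swap_apply_of_ne_of_ne]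
    · rw [hpow]; exact hmin j hj
    · rintro hb
      exact h ⟨(j + 1 : ℕ), by rw [zpow_natCast]; exact hb⟩
  rw [zpow_natCast, pow_succ', mul_apply, key, mul_apply, ← mul_apply σ, ← pow_succ', hpow, hn,
    swap_apply_left]

/-- The orbit of `a` follows `σ` until the step that would first reach `b`, which is redirected to
`a`: the orbit closes without containing `b`. -/
theorem not_sameCycle_swap_mul_of_sameCycle [Finite α] {σ : Perm α} {a b : α} (hab : a ≠ b)
    (h : σ.SameCycle a b) : ¬ (swap a b * σ).SameCycle a b := by
  obtain ⟨n, hn, hmin⟩ := exists_minimal_pow (σ := σ) (a := σ a) (b := b)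
    (sameCycle_apply_left.2 h)
  obtain ⟨n', hn', hmin'⟩ := exists_minimal_pow h
  have hpos : n' ≠ 0 := by rintro rfl; exact hab hn'
  -- A return to `a` before time `n'` would give a shorter way to `b`.
  have hne : ∀ j, 0 < j → j < n' → (σ ^ j) a ≠ a := by
    intro j hj hjn hja
    refine hmin' (n' - j) (by omega) ?_
    conv_lhs => rw [← hja]
    rw [← mul_apply, ← pow_add, Nat.sub_add_cancel hjn.le, hn']
  have key : ∀ j < n', ((swap a b * σ) ^ j) a = (σ ^ j) a := by
    intro j hj
    refine pow_eq_pow_of_eq_on (n := n' - 1) (fun i hi => ?_) (by omega)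
    rw [mul_apply, ← mul_apply σ, ← pow_succ', swap_apply_of_ne_of_ne]
    · exact hne _ (by omega) (by omega)
    · exact hmin' _ (by omega)
  have hper : ((swap a b * σ) ^ n') a = a := by
    obtain ⟨k, rfl⟩ := Nat.exists_eq_succ_of_ne_zero hpos
    rw [pow_succ', mul_apply, key k (Nat.lt_succ_self k), mul_apply, ← mul_apply σ, ← pow_succ',
      hn', swap_apply_right]
  intro hs
  obtain ⟨i, hi⟩ := hs.exists_nat_pow_eq
  have hmul : ∀ q : ℕ, ((swap a b * σ) ^ (n' * q)) a = a := fun q => by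
    rw [pow_mul]
    exact pow_apply_eq_self_of_apply_eq_self hper q
  rw [← Nat.mod_add_div i n', pow_add, mul_apply, hmul,
    key _ (Nat.mod_lt _ (by omega))] at hi
  exact hmin' _ (Nat.mod_lt _ (by omega)) hi

theorem sameCycle_swap_mul {σ : Perm α} {a b : α} (h : (swap a b * σ).SameCycle a b)
    {y z : α} (hs : σ.SameCycle y z) : (swap a b * σ).SameCycle y z := by
  refine rel_of_sameCycle (sameCycle_equivalence _) (fun y => ?_) hs
  have h1 : (swap a b * σ).SameCycle y ((swap a b * σ) y) :=
    sameCycle_apply_right.2 (SameCycle.refl _ _)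
  rw [mul_apply] at h1
  by_cases ha : σ y = a
  · rw [ha, swap_apply_left] at h1
    rw [ha]; exact h1.trans h.symm
  by_cases hb : σ y = b
  · rw [hb, swap_apply_right] at h1
    rw [hb]; exact h1.trans h
  · rwa [swap_apply_of_ne_of_ne ha hb] at h1

/-- The two permutations differ only on the preimages of `a` and `b`, so only the cycles of `a` and
`b` can get joined. -/
theorem sameCycle_or_of_swap_mul {σ : Perm α} {a b : α} {y z : α}
    (hs : (swap a b * σ).SameCycle y z) :
    σ.SameCycle y z ∨ ((σ.SameCycle y a ∨ σ.SameCycle y b) ∧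
      (σ.SameCycle z a ∨ σ.SameCycle z b)) := by
  have e := sameCycle_equivalence σ
  refine rel_of_sameCycle (σ := swap a b * σ) (r := fun y z => σ.SameCycle y z ∨
    ((σ.SameCycle y a ∨ σ.SameCycle y b) ∧ (σ.SameCycle z a ∨ σ.SameCycle z b)))
    ⟨fun y => .inl (e.refl y), fun h => ?_, fun {u v w} h h' => ?_⟩ (fun y => ?_) hs
  · rcases h with h | h
    · exact .inl h.symm
    · exact .inr ⟨h.2, h.1⟩
  · rcases h with h | h <;> rcases h' with h' | h'
    · exact .inl (h.trans h')
    · exact .inr ⟨h'.1.imp h.trans h.trans, h'.2⟩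
    · exact .inr ⟨h.1, h.2.imp h'.symm.trans h'.symm.trans⟩
    · exact .inr ⟨h.1, h'.2⟩
  · have h1 : σ.SameCycle y (σ y) := sameCycle_apply_right.2 (SameCycle.refl _ _)
    rw [mul_apply]
    by_cases ha : σ y = a
    · rw [ha] at h1 ⊢
      rw [swap_apply_left]
      exact .inr ⟨.inl h1, .inr (e.refl _)⟩
    by_cases hb : σ y = b
    · rw [hb] at h1 ⊢
      rw [swap_apply_right]
      exact .inr ⟨.inr h1, .inl (e.refl _)⟩
    · rw [swap_apply_of_ne_of_ne ha hb]
      exact .inl h1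

/-- Multiplying by a transposition of elements of distinct cycles merges these cycles. -/
theorem cycleCount_swap_mul [Finite α] {σ : Perm α} {a b : α} (h : ¬ σ.SameCycle a b) :
    cycleCount (swap a b * σ) + 1 = cycleCount σ := by
  classical
  have hab := sameCycle_swap_mul_of_not_sameCycle h
  let qa : Quotient (SameCycle.setoid σ) := Quotient.mk _ a
  let F : Quotient (SameCycle.setoid σ) → Quotient (SameCycle.setoid (swap a b * σ)) :=
    Quotient.map id (fun _ _ hs => sameCycle_swap_mul hab hs)
  -- The merged cycle is represented by `b`, so `F` becomes bijective once the class of `a` is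
  -- discarded.
  have hbij : Function.Bijective (fun q : {q // q ≠ qa} => F q.1) := by
    constructor
    · rintro ⟨u, hu⟩ ⟨v, hv⟩ huv
      induction u using Quotient.inductionOn with | _ u
      induction v using Quotient.inductionOn with | _ v
      have hs : (swap a b * σ).SameCycle u v := Quotient.exact huv
      have hu' : ¬ σ.SameCycle u a := fun hh => hu (Quotient.sound hh)
      have hv' : ¬ σ.SameCycle v a := fun hh => hv (Quotient.sound hh)
      refine Subtype.ext (Quotient.sound ?_)
      rcases sameCycle_or_of_swap_mul hs with hh | ⟨h1, h2⟩
      · exact hh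
      · exact (h1.resolve_left hu').trans (h2.resolve_left hv').symm
    · intro v
      induction v using Quotient.inductionOn with | _ v
      by_cases hv : σ.SameCycle v a
      · refine ⟨⟨Quotient.mk _ b, fun hh => h ?_⟩, Quotient.sound ?_⟩
        · have h1 : σ.SameCycle b a := Quotient.exact hh
          exact h1.symm
        · exact hab.symm.trans (sameCycle_swap_mul hab hv).symm
      · exact ⟨⟨Quotient.mk _ v, fun hh => hv (Quotient.exact hh)⟩, rfl⟩
  rw [cycleCount, cycleCount, ← Nat.card_congr (Equiv.ofBijective _ hbij),
    ← Nat.card_congr (Equiv.optionSubtypeNe qa), Finite.card_option]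

/-- Multiplying by a transposition of distinct elements of a cycle splits this cycle. -/
theorem cycleCount_swap_mul_of_sameCycle [Finite α] {σ : Perm α} {a b : α} (hab : a ≠ b)
    (h : σ.SameCycle a b) : cycleCount (swap a b * σ) = cycleCount σ + 1 := by
  -- The product separates `a` from `b`, and multiplying it again by the same transposition merges
  -- them and gives `σ` back.
  have := cycleCount_swap_mul (not_sameCycle_swap_mul_of_sameCycle hab h)
  rw [swap_mul_self_mul] at this
  exact this.symm

/-- Moving `a` elsewhere in a permutation does not change the cycles of the other elements. -/
theorem sameCycle_of_sameCycle_move {σ : Perm α} {a x : α} (hx : x ≠ a) {y z : α} (hy : y ≠ a)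
    (hz : z ≠ a) (h : (swap a x * (swap a (σ a) * σ)).SameCycle y z) : σ.SameCycle y z := by
  -- The moved element `a` is now sent to `x`. With `a` replaced by `x`, each step of the new
  -- permutation stays in a cycle of `σ`.
  let ρ : α → α := fun y => if y = a then x else y
  have hρ : ∀ y, y ≠ a → ρ y = y := fun y hy => if_neg hy
  have hr : Equivalence fun y z => σ.SameCycle (ρ y) (ρ z) :=
    ⟨fun _ => SameCycle.refl _ _, SameCycle.symm, SameCycle.trans⟩
  have key : σ.SameCycle (ρ y) (ρ z) := by
    refine rel_of_sameCycle hr (fun y => ?_) h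
    rw [mul_apply, mul_apply]
    by_cases hya : y = a
    · subst hya
      rw [swap_apply_right, swap_apply_left, hρ x hx]
      simp [ρ, SameCycle.refl]
    have hmem : ∃ u, u ≠ a ∧ σ.SameCycle y u ∧ swap a (σ a) (σ y) = u := by
      refine ⟨_, ?_, ?_, rfl⟩
      · intro h
        rw [swap_apply_eq_iff, swap_apply_left] at h
        exact hya (σ.injective h)
      · by_cases hl : σ y = a
        · rw [hl, swap_apply_left, sameCycle_apply_right, ← hl, sameCycle_apply_right]
        · rw [swap_apply_of_ne_of_ne hl fun h => hya (σ.injective h), sameCycle_apply_right]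
    obtain ⟨u, hu, hyu, heq⟩ := hmem
    rw [heq, hρ y hya]
    by_cases hux : u = x
    · subst hux
      simpa [ρ] using hyu
    · rw [swap_apply_of_ne_of_ne hu hux, hρ u hu]
      exact hyu
  rwa [hρ y hy, hρ z hz] at key

/-- Moving `a` back in front of `σ a` is a move of the same kind, and restores `σ`. -/
theorem sameCycle_move_iff {σ : Perm α} {a x : α} (ha : σ a ≠ a) (hx : x ≠ a) {y z : α}
    (hy : y ≠ a) (hz : z ≠ a) :
    (swap a x * (swap a (σ a) * σ)).SameCycle y z ↔ σ.SameCycle y z := by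
  refine ⟨sameCycle_of_sameCycle_move hx hy hz, fun h => ?_⟩
  refine sameCycle_of_sameCycle_move ha hy hz ?_
  rw [mul_apply, mul_apply, swap_apply_right, swap_apply_left, swap_mul_self_mul,
    swap_mul_self_mul]
  exact h

end Cycles

namespace ShadedMap

open Equiv Equiv.Perm

variable {E ι : Type} (m : ShadedMap E ι)

/-! ### Vertices, paths and distances -/

@[simp] theorem darkExt_inl (e : E) : m.darkExt (Sum.inl e) = Sum.inl (m.dark e) := rfl

@[simp] theorem darkExt_inr (i : ι) : m.darkExt (Sum.inr i) = Sum.inr i := rfl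

theorem vertexAt_eq_iff {x y : E ⊕ ι} :
    m.vertexAt x = m.vertexAt y ↔ m.turn.SameCycle x y :=
  Quotient.eq (r := SameCycle.setoid m.turn)

theorem turn_darkExt (x : E ⊕ ι) : m.turn (m.darkExt x) = m.light x := by simp [turn]

theorem vertexAt_turn (x : E ⊕ ι) : m.vertexAt (m.turn x) = m.vertexAt x :=
  m.vertexAt_eq_iff.2 (sameCycle_apply_left.2 (SameCycle.refl _ _))

theorem vertexAt_turn_pow (n : ℕ) (x : E ⊕ ι) : m.vertexAt ((m.turn ^ n) x) = m.vertexAt x :=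
  m.vertexAt_eq_iff.2 (sameCycle_pow_left.2 (SameCycle.refl _ _))

theorem vertexAt_darkExt (x : E ⊕ ι) : m.vertexAt (m.darkExt x) = m.vertexAt (m.light x) := by
  rw [← turn_darkExt, vertexAt_turn]

theorem vertexAt_surjective : Function.Surjective m.vertexAt := Quotient.mk_surjective

theorem isPath_append {u v : m.Vertex} {γ γ' : List E} :
    m.IsPath u (γ ++ γ') v ↔ ∃ w, m.IsPath u γ w ∧ m.IsPath w γ' v := by
  induction γ generalizing u with
  | nil => simp [IsPath]
  | cons e γ ih => simp [IsPath, ih, and_assoc]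

/-- The map is strongly connected. -/
def IsStronglyConnected : Prop := ∀ v w : m.Vertex, ∃ γ, m.IsPath v γ w

/-- The map is connected. -/
def IsConnected : Prop :=
  ∀ x y : E ⊕ ι, ∃ g ∈ Subgroup.closure {m.light, m.darkExt}, g x = y

/-- This form allows connectedness to be transferred between maps by comparing compatible
equivalence relations, without words in the generators. -/
theorem isConnected_iff : m.IsConnected ↔ ∀ r : E ⊕ ι → E ⊕ ι → Prop, Equivalence r →
    (∀ y, r y (m.light y)) → (∀ y, r y (m.darkExt y)) → ∀ x y, r x y := by
  constructor
  · intro h r hr hl hd x y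
    obtain ⟨g, hg, rfl⟩ := h x y
    induction hg using Subgroup.closure_induction generalizing x with
    | mem g hg =>
      rcases hg with rfl | hg
      · exact hl x
      · rw [Set.mem_singleton_iff.1 hg]; exact hd x
    | one => exact hr.refl x
    | mul a b _ _ ha hb => exact hr.trans (hb x) (ha (b x))
    | inv a _ ha =>
      exact hr.symm (by simpa using ha (a⁻¹ x))
  · intro h
    refine h _ ⟨fun x => ⟨1, one_mem _, rfl⟩, ?_, ?_⟩ ?_ ?_
    · rintro x y ⟨g, hg, rfl⟩
      exact ⟨g⁻¹, inv_mem hg, by simp⟩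
    · rintro x y z ⟨g, hg, rfl⟩ ⟨g', hg', rfl⟩
      exact ⟨g' * g, mul_mem hg' hg, rfl⟩
    · exact fun y => ⟨_, Subgroup.subset_closure (by simp), rfl⟩
    · exact fun y => ⟨_, Subgroup.subset_closure (by simp), rfl⟩

variable {m}

/-- The contour of the dark face incident to `e` is an oriented closed path; following it after `e`
leads back to the origin of `e`. -/
theorem exists_isPath_origin [Finite E] (e : E) :
    ∃ γ, m.IsPath (m.terminus e) γ (m.origin e) := by
  have key : ∀ n : ℕ, ∃ γ, m.IsPath (m.terminus e) γ (m.origin ((m.dark ^ (n + 1)) e)) := by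
    intro n
    induction n with
    | zero =>
      exact ⟨[], by simpa [IsPath, origin, terminus] using (m.vertexAt_darkExt (.inl e)).symm⟩
    | succ n ih =>
      obtain ⟨γ, hγ⟩ := ih
      refine ⟨γ ++ [(m.dark ^ (n + 1)) e], m.isPath_append.2 ⟨_, hγ, rfl, ?_⟩⟩
      rw [pow_succ' _ (n + 1), mul_apply]
      exact (m.vertexAt_darkExt (.inl ((m.dark ^ (n + 1)) e))).symm
  obtain ⟨γ, hγ⟩ := key (orderOf m.dark - 1)
  rw [Nat.sub_add_cancel (orderOf_pos _), pow_orderOf_eq_one] at hγ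
  exact ⟨γ, hγ⟩

/-- Each edge can be undone by going round its dark face, so orientations do not obstruct
connectedness. -/
theorem IsConnected.isStronglyConnected [Finite E] (h : m.IsConnected) :
    m.IsStronglyConnected := by
  have htrans : ∀ u v w : m.Vertex, (∃ γ, m.IsPath u γ v) → (∃ γ, m.IsPath v γ w) →
      ∃ γ, m.IsPath u γ w := by
    rintro u v w ⟨γ, hγ⟩ ⟨γ', hγ'⟩
    exact ⟨γ ++ γ', m.isPath_append.2 ⟨v, hγ, hγ'⟩⟩
  let r : E ⊕ ι → E ⊕ ι → Prop := fun x y =>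
    (∃ γ, m.IsPath (m.vertexAt x) γ (m.vertexAt y)) ∧
      ∃ γ, m.IsPath (m.vertexAt y) γ (m.vertexAt x)
  have hr : Equivalence r := ⟨fun x => ⟨⟨[], rfl⟩, ⟨[], rfl⟩⟩, fun h => ⟨h.2, h.1⟩,
    fun h h' => ⟨htrans _ _ _ h.1 h'.1, htrans _ _ _ h'.2 h.2⟩⟩
  have hl : ∀ y, r y (m.light y) := by
    rintro (e | i)
    · exact ⟨⟨[e], rfl, rfl⟩, exists_isPath_origin e⟩
    · have := m.vertexAt_darkExt (.inr i)
      rw [darkExt_inr] at this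
      exact ⟨⟨[], this⟩, ⟨[], this.symm⟩⟩
  have hd : ∀ y, r y (m.darkExt y) := by
    intro y
    have := hl y
    simp only [r, m.vertexAt_darkExt] at this ⊢
    exact this
  intro v w
  obtain ⟨x, rfl⟩ := m.vertexAt_surjective v
  obtain ⟨y, rfl⟩ := m.vertexAt_surjective w
  exact (m.isConnected_iff.1 h r hr hl hd x y).1

theorem dist_le_of_isPath {v w : m.Vertex} {γ : List E} (h : m.IsPath v γ w) :
    m.dist v w ≤ γ.length := Nat.sInf_le ⟨γ, h, rfl⟩

theorem IsStronglyConnected.exists_isPath_length_eq_dist (h : m.IsStronglyConnected)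
    (v w : m.Vertex) : ∃ γ, m.IsPath v γ w ∧ γ.length = m.dist v w := by
  obtain ⟨γ, hγ⟩ := h v w
  exact Nat.sInf_mem (s := {k | ∃ γ : List E, m.IsPath v γ w ∧ γ.length = k}) ⟨_, γ, hγ, rfl⟩

theorem dist_self (v : m.Vertex) : m.dist v v = 0 :=
  Nat.le_zero.1 (dist_le_of_isPath (γ := []) rfl)

theorem IsStronglyConnected.eq_of_dist_eq_zero (h : m.IsStronglyConnected) {v w : m.Vertex}
    (h0 : m.dist v w = 0) : v = w := by
  obtain ⟨γ, hγ, hl⟩ := h.exists_isPath_length_eq_dist v w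
  rw [h0, List.length_eq_zero_iff] at hl
  subst hl
  exact hγ

theorem IsStronglyConnected.dist_origin_le (h : m.IsStronglyConnected) (e : E) (w : m.Vertex) :
    m.dist (m.origin e) w ≤ m.dist (m.terminus e) w + 1 := by
  obtain ⟨γ, hγ, hl⟩ := h.exists_isPath_length_eq_dist (m.terminus e) w
  rw [← hl]
  exact dist_le_of_isPath (γ := e :: γ) ⟨rfl, hγ⟩

/-- From any vertex other than `w`, some edge goes closer to `w`. -/
theorem IsStronglyConnected.exists_isCloser (h : m.IsStronglyConnected) {v w : m.Vertex}
    (hv : v ≠ w) : ∃ e, m.origin e = v ∧ m.IsCloser w e := by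
  obtain ⟨γ, hγ, hl⟩ := h.exists_isPath_length_eq_dist v w
  cases γ with
  | nil => exact absurd hγ hv
  | cons e γ =>
    refine ⟨e, hγ.1, le_antisymm ?_ (h.dist_origin_le e w)⟩
    rw [hγ.1, ← hl]
    exact Nat.succ_le_succ (dist_le_of_isPath hγ.2)

/-- A function on the vertices that increases at most by one along each edge increases at most by
the distance. -/
theorem IsStronglyConnected.le_add_dist (h : m.IsStronglyConnected) (g : m.Vertex → ℤ)
    (hg : ∀ e, g (m.terminus e) ≤ g (m.origin e) + 1) (v w : m.Vertex) :
    g w ≤ g v + m.dist v w := by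
  obtain ⟨γ, hγ, hl⟩ := h.exists_isPath_length_eq_dist v w
  rw [← hl]
  clear hl
  induction γ generalizing v with
  | nil => rw [show v = w from hγ]; simp
  | cons e γ ih =>
    have h1 := ih _ hγ.2
    have h2 := hg e
    rw [hγ.1] at h2
    push_cast [List.length_cons]
    linarith

/-! ### Lightest geodesics -/

variable (m) in
/-- `γ` starts from the corner preceding `x`, ends at `w`, goes closer to `w` at each step, and
takes each time the first possible edge. -/
def IsLightest (w : m.Vertex) : E ⊕ ι → List E → Prop
  | x, [] => m.vertexAt x = w
  | x, e :: γ => (∃ n : ℕ, (m.turn ^ n) x = Sum.inl e ∧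
      ∀ j < n, ∀ f, (m.turn ^ j) x = Sum.inl f → ¬ m.IsCloser w f) ∧
      m.IsCloser w e ∧ IsLightest w (m.light (Sum.inl e)) γ

theorem firstCloser_eq_some_iff {w : m.Vertex} {x : E ⊕ ι} {e : E} :
    m.firstCloser w x = some e ↔ (∃ n : ℕ, (m.turn ^ n) x = Sum.inl e ∧
      ∀ j < n, ∀ f, (m.turn ^ j) x = Sum.inl f → ¬ m.IsCloser w f) ∧ m.IsCloser w e := by
  classical
  unfold firstCloser
  constructor
  · intro he
    split_ifs at he with h
    have hs := (Nat.find_spec h).choose_spec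
    rw [Option.some.inj he] at hs
    exact ⟨⟨Nat.find h, hs.1, fun j hj f hf hc => Nat.find_min h hj ⟨f, hf, hc⟩⟩, hs.2⟩
  · rintro ⟨⟨n, hn, hmin⟩, hc⟩
    have h : ∃ i : ℕ, ∃ e : E, (m.turn ^ i) x = Sum.inl e ∧ m.IsCloser w e := ⟨n, e, hn, hc⟩
    rw [dif_pos h]
    have hfind : Nat.find h = n := by
      refine (Nat.find_eq_iff h).2 ⟨⟨e, hn, hc⟩, ?_⟩
      rintro j hj ⟨f, hf, hfc⟩
      exact hmin j hj f hf hfc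
    have hs := (Nat.find_spec h).choose_spec.1
    have h2 : (m.turn ^ Nat.find h) x = Sum.inl e := by rw [hfind, hn]
    rw [Option.some.injEq]
    exact Sum.inl_injective (hs.symm.trans h2)

theorem IsLightest.length_eq {w : m.Vertex} {x : E ⊕ ι} {γ : List E}
    (h : m.IsLightest w x γ) : γ.length = m.dist (m.vertexAt x) w := by
  induction γ generalizing x with
  | nil => rw [show m.vertexAt x = w from h, dist_self]; rfl
  | cons e γ ih =>
    obtain ⟨⟨n, hn, -⟩, hc, h⟩ := h
    rw [List.length_cons, ih h, ← m.vertexAt_turn_pow n x, hn]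
    exact hc

theorem IsLightest.lightestGeodesic_eq {w : m.Vertex} {x : E ⊕ ι} {γ : List E}
    (h : m.IsLightest w x γ) : m.lightestGeodesic x w = γ := by
  rw [lightestGeodesic, ← h.length_eq]
  induction γ generalizing x with
  | nil => rfl
  | cons e γ ih =>
    rw [List.length_cons, lightestFrom, firstCloser_eq_some_iff.2 ⟨h.1, h.2.1⟩]
    simp only [ih h.2.2]

/-- Away from `w` some outgoing edge goes closer, so `firstCloser` does not fail before `w` is
reached, which takes exactly `dist` steps. -/
theorem IsStronglyConnected.isLightest_lightestGeodesic [Finite E] [Finite ι]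
    (hm : m.IsStronglyConnected) (w : m.Vertex) (x : E ⊕ ι) :
    m.IsLightest w x (m.lightestGeodesic x w) := by
  suffices ∀ k x, m.dist (m.vertexAt x) w = k → ∃ γ, m.IsLightest w x γ by
    obtain ⟨γ, hγ⟩ := this _ x rfl
    rwa [hγ.lightestGeodesic_eq]
  intro k
  induction k with
  | zero => exact fun x hx => ⟨[], hm.eq_of_dist_eq_zero hx⟩
  | succ k ih =>
    intro x hx
    obtain ⟨f, hf, hfc⟩ := hm.exists_isCloser (v := m.vertexAt x) (w := w) (by
      intro h; rw [h, dist_self] at hx; omega)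
    obtain ⟨n, hn⟩ := (m.vertexAt_eq_iff.1 hf.symm).exists_nat_pow_eq
    cases he : m.firstCloser w x with
    | none =>
      unfold firstCloser at he
      rw [dif_pos ⟨n, f, hn, hfc⟩] at he
      cases he
    | some e =>
      obtain ⟨⟨i, hi, hmin⟩, hc⟩ := firstCloser_eq_some_iff.1 he
      have h1 : m.dist (m.vertexAt (m.light (.inl e))) w = k := by
        have h2 : m.vertexAt x = m.origin e := by rw [← m.vertexAt_turn_pow i, hi]; rfl
        have h3 : m.dist (m.terminus e) w + 1 = m.dist (m.origin e) w := hc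
        rw [← h2, hx] at h3
        exact Nat.succ_injective h3
      obtain ⟨γ, hγ⟩ := ih _ h1
      exact ⟨e :: γ, ⟨i, hi, hmin⟩, hc, hγ⟩

/-! ### Reversing all the edges -/

theorem reverse_darkExt : m.reverse.darkExt = m.darkExt⁻¹ := by
  rw [eq_inv_iff_mul_eq_one]
  ext x
  rcases x with x | x <;> simp [darkExt, reverse]

theorem reverse_turn : m.reverse.turn = m.light⁻¹ * m.darkExt := by
  rw [turn, reverse_darkExt, inv_inv]; rfl

/-- Once corners are translated by `light`, turning in the reversed map is turning backward in `m`.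
-/
theorem light_reverse_turn_pow (n : ℕ) (x : E ⊕ ι) :
    m.light ((m.reverse.turn ^ n) x) = (m.turn⁻¹ ^ n) (m.light x) := by
  induction n with
  | zero => rfl
  | succ n ih =>
    rw [pow_succ', mul_apply, pow_succ', mul_apply, ← ih, reverse_turn, turn]
    simp

theorem reverse_turn_sameCycle {x y : E ⊕ ι} :
    m.reverse.turn.SameCycle x y ↔ m.turn.SameCycle (m.light x) (m.light y) := by
  have : m.reverse.turn = m.light⁻¹ * m.turn⁻¹ * (m.light⁻¹)⁻¹ := by
    rw [reverse_turn, turn]; group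
  rw [this, sameCycle_conj, inv_inv, sameCycle_inv]

variable (m) in
/-- The vertices do not depend on the orientation. -/
def reverseVertex : m.reverse.Vertex ≃ m.Vertex :=
  Quotient.congr m.light fun _ _ => reverse_turn_sameCycle

theorem reverseVertex_vertexAt (x : E ⊕ ι) :
    m.reverseVertex (m.reverse.vertexAt x) = m.vertexAt (m.light x) := rfl

theorem reverseVertex_origin (e : E) : m.reverseVertex (m.reverse.origin e) = m.terminus e := rfl

theorem reverseVertex_terminus (e : E) : m.reverseVertex (m.reverse.terminus e) = m.origin e := by
  rw [terminus, reverseVertex_vertexAt]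
  simp [reverse, origin]

theorem isPath_of_reverse {γ : List E} {v w : m.reverse.Vertex} (h : m.reverse.IsPath v γ w) :
    m.IsPath (m.reverseVertex w) γ.reverse (m.reverseVertex v) := by
  induction γ generalizing v with
  | nil => rw [show v = w from h]; rfl
  | cons e γ ih =>
    rw [List.reverse_cons, isPath_append]
    refine ⟨_, ih h.2, (reverseVertex_terminus e).symm, ?_⟩
    rw [← h.1]; rfl

theorem isPath_reverse {γ : List E} {v w : m.reverse.Vertex} :
    m.IsPath (m.reverseVertex w) γ (m.reverseVertex v) ↔ m.reverse.IsPath v γ.reverse w := by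
  constructor
  · induction γ generalizing w with
    | nil => intro h; exact (m.reverseVertex.injective h).symm
    | cons e γ ih =>
      intro h
      obtain ⟨u, hu⟩ := m.reverseVertex.surjective (m.terminus e)
      rw [List.reverse_cons, isPath_append]
      refine ⟨u, ih (by rw [hu]; exact h.2), ?_, ?_⟩
      · exact m.reverseVertex.injective (by rw [hu, reverseVertex_origin])
      · exact m.reverseVertex.injective (by rw [reverseVertex_terminus, h.1])
  · intro h
    simpa using isPath_of_reverse h

theorem dist_reverse (v w : m.reverse.Vertex) :
    m.reverse.dist v w = m.dist (m.reverseVertex w) (m.reverseVertex v) := by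
  unfold dist
  congr 1
  ext k
  constructor
  · rintro ⟨γ, h, hk⟩
    exact ⟨γ.reverse, isPath_of_reverse h, by simpa using hk⟩
  · rintro ⟨γ, h, hk⟩
    exact ⟨γ.reverse, isPath_reverse.1 h, by simpa using hk⟩

/-- Reversal exchanges the two ends of an edge and the two arguments of the distance. -/
theorem isCloser_reverse_iff {w : m.reverse.Vertex} {e : E} :
    m.reverse.IsCloser w e ↔ m.IsLeaving (m.reverseVertex w) e := by
  rw [IsCloser, IsLeaving, dist_reverse, dist_reverse, reverseVertex_terminus,
    reverseVertex_origin, eq_comm]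

theorem isLeaving_reverse_iff {w : m.reverse.Vertex} {e : E} :
    m.reverse.IsLeaving w e ↔ m.IsCloser (m.reverseVertex w) e := by
  rw [IsCloser, IsLeaving, dist_reverse, dist_reverse, reverseVertex_terminus,
    reverseVertex_origin, eq_comm]

theorem IsConnected.reverse (h : m.IsConnected) : m.reverse.IsConnected := by
  rw [isConnected_iff] at h ⊢
  intro r hr hl hd
  refine h r hr (fun y => ?_) (fun y => ?_)
  · simpa [ShadedMap.reverse] using hr.symm (hl (m.light y))
  · simpa [reverse_darkExt] using hr.symm (hd (m.darkExt y))

theorem IsHypermap.reverse {p : ℕ} (h : m.IsHypermap p) : m.reverse.IsHypermap p where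
  connected := IsConnected.reverse h.connected
  dark_degree e := by
    rw [← h.dark_degree e]
    refine Nat.dvd_antisymm ?_ ?_ <;> rw [← Function.isPeriodicPt_iff_minimalPeriod_dvd]
    · have := Function.isPeriodicPt_minimalPeriod m.dark e
      rw [Function.IsPeriodicPt, Function.IsFixedPt, iterate_eq_pow] at this ⊢
      rw [ShadedMap.reverse, inv_pow, inv_eq_iff_eq, this]
    · have := Function.isPeriodicPt_minimalPeriod m.reverse.dark e
      rw [Function.IsPeriodicPt, Function.IsFixedPt, iterate_eq_pow] at this ⊢
      rw [ShadedMap.reverse, inv_pow, inv_eq_iff_eq] at this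
      exact this.symm
  spherical := by
    rw [← h.spherical]
    congr 1
    · exact Nat.card_congr m.reverseVertex
    · congr 1
      · exact cycleCount_congr (Equiv.refl _) fun _ _ => sameCycle_inv
      · exact cycleCount_congr (Equiv.refl _) fun _ _ => sameCycle_inv

theorem IsMarked.reverse (h : m.IsMarked) : m.reverse.IsMarked := fun x => by
  simpa only [ShadedMap.reverse, sameCycle_inv] using h x

end ShadedMap

namespace ShadedMap

open Equiv Equiv.Perm

variable {E ι : Type} {m : ShadedMap E ι} [DecidableEq E] [DecidableEq ι]

/-! ### Slit-slide-sew along a single edge -/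

theorem slitSlideSew_nil_light (e : E) (x : E ⊕ ι) : (m.slitSlideSew e [] x).light =
    swap (.inl e) x * (swap (.inl e) (m.light (.inl e)) * m.light) := by
  simp [slitSlideSew, matching, slidLight, insertSide, deleteSide]

theorem slitSlideSew_darkExt (e : E) (γ : List E) (x : E ⊕ ι) :
    (m.slitSlideSew e γ x).darkExt = m.darkExt := rfl

/-- The dark contours do not change, so vertices undergo the same two transpositions as light faces.
-/
theorem slitSlideSew_nil_turn (e : E) (x : E ⊕ ι) : (m.slitSlideSew e [] x).turn =
    swap (.inl e) x * (swap (.inl e) (m.light (.inl e)) * m.turn) := by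
  rw [turn, slitSlideSew_darkExt, slitSlideSew_nil_light, turn, mul_assoc, mul_assoc]

theorem slitSlideSew_nil_light_self {e : E} {x : E ⊕ ι} :
    (m.slitSlideSew e [] x).light (.inl e) = x := by
  simp [slitSlideSew_nil_light]

section SingleEdge

variable {e : E} {x : E ⊕ ι}

omit [DecidableEq E] [DecidableEq ι] in
theorem light_ne_of_terminus_ne (he : m.terminus e ≠ m.origin e) :
    (Sum.inl e : E ⊕ ι) ≠ m.light (.inl e) := by
  intro h
  apply he
  rw [terminus, ← h]; rfl

/-- A relation compatible with the new map links `e` to its new successor `x`, so it is compatible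
with the contour where `e` is deleted. Deleting `e` merges its two ends, so `e` is also linked to
its former successor, and the relation is compatible with `m`. -/
theorem IsConnected.slitSlideSew_nil [Finite E] [Finite ι] (hm : m.IsConnected)
    (he : m.terminus e ≠ m.origin e) : (m.slitSlideSew e [] x).IsConnected := by
  rw [isConnected_iff] at hm ⊢
  intro r hr hl hd
  rw [slitSlideSew_darkExt] at hd
  have hx : r (.inl e) x := by
    have := hl (.inl e)
    rwa [slitSlideSew_nil_light_self] at this
  have hswap : ∀ {a b : E ⊕ ι}, r a b → ∀ y, r y (swap a b y) := by
    intro a b hab y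
    rcases eq_or_ne y a with rfl | ha
    · rwa [swap_apply_left]
    rcases eq_or_ne y b with rfl | hb
    · rw [swap_apply_right]; exact hr.symm hab
    · rw [swap_apply_of_ne_of_ne ha hb]; exact hr.refl y
  have hA : ∀ y, r y (swap (.inl e) (m.light (.inl e)) (m.light y)) := by
    intro y
    have h1 := hl y
    rw [slitSlideSew_nil_light, mul_apply, mul_apply] at h1
    exact hr.trans h1 (hr.symm (hswap hx _))
  have hturn : ∀ y, r y ((swap (.inl e) (m.light (.inl e)) * m.turn) y) := by
    intro y
    have h1 := hd (m.darkExt⁻¹ y)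
    have h2 := hA (m.darkExt⁻¹ y)
    rw [← mul_apply, mul_inv_cancel, one_apply] at h1
    exact hr.trans (hr.symm h1) h2
  have hne : ¬ m.turn.SameCycle (.inl e) (m.light (.inl e)) := fun h =>
    he (m.vertexAt_eq_iff.2 h).symm
  have hlight : r (.inl e) (m.light (.inl e)) :=
    rel_of_sameCycle hr hturn (sameCycle_swap_mul_of_not_sameCycle hne)
  exact hm r hr (fun y => hr.trans (hA y) (hr.symm (hswap hlight _))) hd

/-- Deleting the side makes it a fixed point, which adds a cycle; inserting it before `x` removes
this cycle. -/
theorem cycleCount_light_slitSlideSew_nil [Finite E] [Finite ι]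
    (he : m.terminus e ≠ m.origin e) (hxe : x ≠ .inl e) :
    cycleCount (m.slitSlideSew e [] x).light = cycleCount m.light := by
  have h1 := cycleCount_swap_mul_of_sameCycle (light_ne_of_terminus_ne he)
    (sameCycle_apply_right.2 (SameCycle.refl m.light (.inl e)))
  have h2 : ¬ (swap (.inl e) (m.light (.inl e)) * m.light).SameCycle (.inl e) x := by
    intro h
    have hf : Function.IsFixedPt (swap (.inl e) (m.light (.inl e)) * m.light) (.inl e) := by
      simp [Function.IsFixedPt]
    exact hxe (SameCycle.eq_of_left h hf).symm
  have h3 := cycleCount_swap_mul h2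
  rw [slitSlideSew_nil_light]
  omega

/-- The first transposition merges the two ends of `e`; since `x` belongs to the merged cycle, the
second one splits it. -/
theorem cycleCount_turn_slitSlideSew_nil [Finite E] [Finite ι]
    (he : m.terminus e ≠ m.origin e) (hx : m.vertexAt x = m.terminus e) :
    cycleCount (m.slitSlideSew e [] x).turn = cycleCount m.turn := by
  have hne : ¬ m.turn.SameCycle (.inl e) (m.light (.inl e)) := fun h =>
    he (m.vertexAt_eq_iff.2 h).symm
  have hxe : (.inl e : E ⊕ ι) ≠ x := by
    rintro rfl
    exact he hx.symm
  have h1 := cycleCount_swap_mul hne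
  have h2 := sameCycle_swap_mul_of_not_sameCycle hne
  have h3 := cycleCount_swap_mul_of_sameCycle hxe
    (h2.trans (sameCycle_swap_mul h2 (m.vertexAt_eq_iff.1 hx.symm)))
  rw [slitSlideSew_nil_turn]
  omega

theorem IsHypermap.slitSlideSew_nil [Finite E] [Finite ι] {p : ℕ} (hm : m.IsHypermap p)
    (he : m.terminus e ≠ m.origin e) (hx : m.vertexAt x = m.terminus e) :
    (m.slitSlideSew e [] x).IsHypermap p where
  connected := IsConnected.slitSlideSew_nil hm.connected he
  dark_degree := hm.dark_degree
  spherical := by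
    rw [← hm.spherical]
    have hxe : x ≠ .inl e := by
      rintro rfl
      exact he hx.symm
    congr 1
    · exact cycleCount_turn_slitSlideSew_nil he hx
    · congr 1
      exact cycleCount_light_slitSlideSew_nil he hxe

theorem IsMarked.slitSlideSew_nil (hm : m.IsMarked) (he : m.terminus e ≠ m.origin e)
    (hxe : x ≠ .inl e) : (m.slitSlideSew e [] x).IsMarked := by
  have key : ∀ y : E ⊕ ι, y ≠ .inl e →
      ∃! i : ι, (m.slitSlideSew e [] x).light.SameCycle y (.inr i) := by
    intro y hy
    simpa only [slitSlideSew_nil_light, sameCycle_move_iff (light_ne_of_terminus_ne he).symm hxe hy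
      (Sum.inr_ne_inl)] using hm y
  intro y
  by_cases hy : y = .inl e
  · subst hy
    have hs : (m.slitSlideSew e [] x).light.SameCycle (.inl e) x :=
      ⟨1, by rw [zpow_one, slitSlideSew_nil_light_self]⟩
    obtain ⟨i, hi, hu⟩ := key x hxe
    exact ⟨i, hs.trans hi, fun j hj => hu j (hs.symm.trans hj)⟩
  · exact key y hy

/-- The transposed elements `e`, its successor and `x` all lie at the ends of `e`. -/
theorem slitSlideSew_nil_turn_apply {y : E ⊕ ι} (he : m.vertexAt y ≠ m.origin e)
    (ht : m.vertexAt y ≠ m.terminus e) (hx : m.vertexAt x = m.terminus e) :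
    (m.slitSlideSew e [] x).turn y = m.turn y := by
  have h : ∀ z, m.vertexAt z ≠ m.vertexAt y → m.turn y ≠ z := by
    rintro z hz rfl
    exact hz (m.vertexAt_turn y)
  rw [slitSlideSew_nil_turn, mul_apply, mul_apply,
    swap_apply_of_ne_of_ne (h _ he.symm) (h _ ht.symm),
    swap_apply_of_ne_of_ne (h _ he.symm) (h _ (by rw [hx]; exact ht.symm))]

/-- The vertices that are not incident to `e` do not change. -/
theorem vertexAt_slitSlideSew_nil_eq_iff [Finite E] [Finite ι] {y z : E ⊕ ι}
    (he : m.vertexAt y ≠ m.origin e) (ht : m.vertexAt y ≠ m.terminus e)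
    (hx : m.vertexAt x = m.terminus e) :
    (m.slitSlideSew e [] x).vertexAt y = (m.slitSlideSew e [] x).vertexAt z ↔
      m.vertexAt y = m.vertexAt z := by
  have key : ∀ n : ℕ, ((m.slitSlideSew e [] x).turn ^ n) y = (m.turn ^ n) y := fun n => by
    refine pow_eq_pow_of_eq_on (n := n) (fun j _ => ?_) le_rfl
    rw [pow_succ', mul_apply]
    exact slitSlideSew_nil_turn_apply (by rwa [vertexAt_turn_pow]) (by rwa [vertexAt_turn_pow]) hx
  rw [vertexAt_eq_iff, vertexAt_eq_iff]
  constructor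
  · intro h
    obtain ⟨n, hn⟩ := h.exists_nat_pow_eq
    exact ⟨n, by rw [zpow_natCast, ← key, hn]⟩
  · intro h
    obtain ⟨n, hn⟩ := h.exists_nat_pow_eq
    exact ⟨n, by rw [zpow_natCast, key, hn]⟩

end SingleEdge

/-! ### Slit-slide-sew along a simple path -/

/-- The element following the corner through which a path leaves its current vertex, when its next
edges are `γ` and its exit corner precedes `x`. -/
def exitAt (γ : List E) (x : E ⊕ ι) : E ⊕ ι := (γ.map Sum.inl).headD x

variable (m) in
/-- `γ` is a path visiting distinct vertices and ending at the vertex of `x`. -/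
def IsSimplePath : List E → E ⊕ ι → Prop
  | [], _ => True
  | e :: γ, x => m.vertexAt (exitAt γ x) = m.terminus e ∧ m.vertexAt x ≠ m.origin e ∧
      (∀ f ∈ γ, m.origin f ≠ m.origin e) ∧ IsSimplePath γ x

omit [DecidableEq E] [DecidableEq ι] in
theorem IsSimplePath.terminus_ne_origin {e : E} {γ : List E} {x : E ⊕ ι}
    (h : m.IsSimplePath (e :: γ) x) : m.terminus e ≠ m.origin e := by
  rw [← h.1]
  cases γ with
  | nil => exact h.2.1
  | cons f γ => exact h.2.2.1 f (by simp)

/-- Sliding along a path amounts to sliding along its edges one after the other. -/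
theorem slitSlideSew_cons {e e' : E} {γ : List E} {x : E ⊕ ι} (hee : e ≠ e') (he : x ≠ .inl e)
    (he' : x ≠ .inl e') : m.slitSlideSew e (e' :: γ) x =
      (m.slitSlideSew e [] (.inl e')).slitSlideSew e' γ x := by
  have hne : (Sum.inl e : E ⊕ ι) ≠ .inl e' := fun h => hee (Sum.inl_injective h)
  have key : (m.slitSlideSew e (e' :: γ) x).light =
      ((m.slitSlideSew e [] (.inl e')).slitSlideSew e' γ x).light := by
    have h1 : (m.slitSlideSew e [] (.inl e')).light (.inl e) = .inl e' :=
      slitSlideSew_nil_light_self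
    -- The first slide puts the side `e` just before `e'`. Deleting `e'` and inserting it before `x`
    -- then amounts to moving the first side directly to `x`, with the names `e` and `e'` exchanged.
    -- This exchange is the first factor of the cycle `matching`.
    have h2 : slidLight (m.slitSlideSew e [] (.inl e')) e' x =
        swap (.inl e) (.inl e') * slidLight m e x * swap (.inl e) (.inl e') := by
      have h3 : swap (.inl e') ((m.slitSlideSew e [] (.inl e')).light (.inl e')) *
          (m.slitSlideSew e [] (.inl e')).light =
          (m.slitSlideSew e [] (.inl e')).light * swap (.inl e) (.inl e') := by
        have := swap_apply_apply (m.slitSlideSew e [] (.inl e')).light (.inl e) (.inl e')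
        rw [h1] at this
        rw [this, inv_mul_cancel_right]
      have h4 : swap (.inl e) (.inl e') * swap (.inl e) x =
          swap (.inl e') x * swap (.inl e) (.inl e') := by
        have := swap_apply_apply (swap (.inl e) (.inl e')) (.inl e) x
        rw [swap_apply_left, swap_apply_of_ne_of_ne he he'] at this
        rw [this, inv_mul_cancel_right]
      rw [slidLight, insertSide, deleteSide, h3, slitSlideSew_nil_light, slidLight, insertSide,
        deleteSide, ← mul_assoc (swap (.inl e) (.inl e')) (swap (.inl e) x), h4]
      simp only [mul_assoc]
    have h5 : matching (ι := ι) (e :: e' :: γ) =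
        swap (.inl e) (.inl e') * matching (e' :: γ) := by
      simp only [matching, List.map_cons, List.formPerm_cons_cons]
    have h6 : ∀ (M : ShadedMap E ι) (γ : List E), (M.slitSlideSew e' γ x).light =
      (matching (e' :: γ))⁻¹ * slidLight M e' x * matching (e' :: γ) := fun _ _ => rfl
    rw [h6, h2, slitSlideSew, h5, mul_inv_rev, swap_inv]
    simp only [mul_assoc]
  exact (ShadedMap.mk.injEq ..).symm ▸ ⟨key, rfl⟩

theorem IsSimplePath.slitSlideSew_nil [Finite E] [Finite ι] {e : E} {y x : E ⊕ ι} {γ : List E}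
    (hy : m.vertexAt y = m.terminus e) (hxe : m.vertexAt x ≠ m.origin e)
    (hxt : m.vertexAt x ≠ m.terminus e) (hγe : ∀ f ∈ γ, m.origin f ≠ m.origin e)
    (hγt : ∀ f ∈ γ, m.origin f ≠ m.terminus e) (h : m.IsSimplePath γ x) :
    (m.slitSlideSew e [] y).IsSimplePath γ x := by
  induction γ with
  | nil => trivial
  | cons f γ ih =>
    have hfe := hγe f (by simp)
    have hft := hγt f (by simp)
    have hex : m.vertexAt (exitAt γ x) ≠ m.origin e ∧ m.vertexAt (exitAt γ x) ≠ m.terminus e := by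
      cases γ with
      | nil => exact ⟨hxe, hxt⟩
      | cons g γ => exact ⟨hγe g (by simp), hγt g (by simp)⟩
    refine ⟨?_, ?_, fun g hg => ?_, ih (fun g hg => hγe g (by simp [hg]))
      (fun g hg => hγt g (by simp [hg])) h.2.2.2⟩
    · rw [terminus, vertexAt_slitSlideSew_nil_eq_iff hex.1 hex.2 hy, h.1, terminus]
      have hlf : ∀ z, m.vertexAt z ≠ m.vertexAt (exitAt γ x) → m.light (.inl f) ≠ z := by
        rintro z hz rfl
        exact hz h.1.symm
      rw [slitSlideSew_nil_light, mul_apply, mul_apply,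
        swap_apply_of_ne_of_ne (hlf _ hex.1.symm) (hlf _ hex.2.symm),
        swap_apply_of_ne_of_ne (hlf _ hex.1.symm) (hlf _ (by rw [hy]; exact hex.2.symm))]
    · rw [origin, Ne, vertexAt_slitSlideSew_nil_eq_iff hxe hxt hy]
      exact h.2.1
    · have := h.2.2.1 g hg
      rw [origin, origin, Ne, vertexAt_slitSlideSew_nil_eq_iff (hγe g (by simp [hg]))
        (hγt g (by simp [hg])) hy]
      exact this

/-- A property preserved when sliding along any edge with distinct ends is preserved when sliding
along any simple path. -/
theorem slitSlideSew_induction [Finite E] [Finite ι] {P : ShadedMap E ι → Prop}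
    (hP : ∀ (m : ShadedMap E ι) (e : E) (x : E ⊕ ι), m.terminus e ≠ m.origin e →
      m.vertexAt x = m.terminus e → P m → P (m.slitSlideSew e [] x))
    {e : E} {γ : List E} {x : E ⊕ ι} (h : m.IsSimplePath (e :: γ) x) (hm : P m) :
    P (m.slitSlideSew e γ x) := by
  induction γ generalizing m e with
  | nil => exact hP m e x h.terminus_ne_origin h.1 hm
  | cons e' γ ih =>
    have hne : ∀ f : E, m.vertexAt x ≠ m.origin f → x ≠ .inl f := by
      rintro f hf rfl
      exact hf rfl
    have h1 : m.origin e' = m.terminus e := h.1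
    have h2 : m.vertexAt x ≠ m.terminus e := h1 ▸ h.2.2.2.2.1
    have hγe : ∀ f ∈ γ, m.origin f ≠ m.origin e := fun f hf => h.2.2.1 f (by simp [hf])
    have hγt : ∀ f ∈ γ, m.origin f ≠ m.terminus e := h1 ▸ h.2.2.2.2.2.1
    rw [slitSlideSew_cons (fun hee => h.2.2.1 e' (by simp) (by rw [hee])) (hne e h.2.1)
      (hne e' h.2.2.2.2.1)]
    refine ih ?_ (hP m e _ h.terminus_ne_origin h1 hm)
    have hex : m.vertexAt (exitAt γ x) ≠ m.origin e ∧ m.vertexAt (exitAt γ x) ≠ m.terminus e := by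
      cases γ with
      | nil => exact ⟨h.2.1, h2⟩
      | cons g γ => exact ⟨hγe g (by simp), hγt g (by simp)⟩
    -- The edge `e'` starts at an end of `e`, so the previous lemma only covers `γ`. The conditions
    -- on `e'` are compared through vertices not incident to `e`.
    refine ⟨?_, ?_, fun f hf => ?_,
      IsSimplePath.slitSlideSew_nil h1 h.2.1 h2 hγe hγt h.2.2.2.2.2.2⟩
    · have h3 := h.2.2.2.1
      rw [terminus, vertexAt_slitSlideSew_nil_eq_iff hex.1 hex.2 h1, h3, terminus]
      have hl : ∀ z, m.vertexAt z ≠ m.vertexAt (exitAt γ x) → m.light (.inl e') ≠ z := by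
        rintro z hz rfl
        exact hz h3.symm
      rw [slitSlideSew_nil_light, mul_apply, mul_apply,
        swap_apply_of_ne_of_ne (hl _ hex.1.symm) (hl _ hex.2.symm),
        swap_apply_of_ne_of_ne (hl _ hex.1.symm) (hl _ (by
          rw [show m.vertexAt (.inl e') = _ from h1]; exact hex.2.symm))]
    · rw [origin, Ne, vertexAt_slitSlideSew_nil_eq_iff h.2.1 h2 h1]
      exact h.2.2.2.2.1
    · rw [origin, origin, Ne, vertexAt_slitSlideSew_nil_eq_iff (hγe f hf) (hγt f hf) h1]
      exact h.2.2.2.2.2.1 f hf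

theorem IsHypermap.slitSlideSew [Finite E] [Finite ι] {p : ℕ} (hm : m.IsHypermap p) {e : E}
    {γ : List E} {x : E ⊕ ι} (h : m.IsSimplePath (e :: γ) x) :
    (m.slitSlideSew e γ x).IsHypermap p :=
  slitSlideSew_induction (P := fun m => m.IsHypermap p)
    (fun _ _ _ he hx hm => hm.slitSlideSew_nil he hx) h hm

theorem IsMarked.slitSlideSew [Finite E] [Finite ι] (hm : m.IsMarked) {e : E}
    {γ : List E} {x : E ⊕ ι} (h : m.IsSimplePath (e :: γ) x) :
    (m.slitSlideSew e γ x).IsMarked :=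
  slitSlideSew_induction (P := IsMarked)
    (fun m e x he hx hm => hm.slitSlideSew_nil he (by rintro rfl; exact he hx.symm)) h hm

end ShadedMap

namespace ShadedMap

open Equiv Equiv.Perm

variable {E ι : Type} {m : ShadedMap E ι}

/-! ### Lightest geodesics as sequences of edges -/

/-- Here `s i` represents the corner from which the edge `c i` is searched; the recursive definition
becomes a condition on each index. -/
theorem isLightest_map_range_iff {w : m.Vertex} {k : ℕ} {c : ℕ → E} {s : ℕ → E ⊕ ι}
    (hs : ∀ i, s (i + 1) = m.light (.inl (c i))) :
    m.IsLightest w (s 0) ((List.range k).map c) ↔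
      (∀ i < k, (∃ n : ℕ, (m.turn ^ n) (s i) = Sum.inl (c i) ∧
        ∀ j < n, ∀ f, (m.turn ^ j) (s i) = Sum.inl f → ¬ m.IsCloser w f) ∧ m.IsCloser w (c i)) ∧
      m.vertexAt (s k) = w := by
  induction k generalizing c s with
  | zero => simp [IsLightest]
  | succ k ih =>
    rw [List.range_succ_eq_map, List.map_cons, List.map_map, IsLightest, ← hs 0,
      ih (c := c ∘ Nat.succ) (s := fun i => s (i + 1)) (fun i => hs (i + 1)),
      Nat.forall_lt_succ_left]
    simp only [Function.comp, Nat.succ_eq_add_one, and_assoc]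

/-- The element following the corner through which a path with edges `c 0, …, c (k - 1)` leaves
the end of `c i`, when its exit corner precedes `x`. -/
def nextAt (x : E ⊕ ι) (k : ℕ) (c : ℕ → E) (i : ℕ) : E ⊕ ι :=
  if i + 1 < k then .inl (c (i + 1)) else x

variable (m) in
/-- The edges `c 0, …, c (k - 1)` form a geodesic to the vertex of `x`, which is lightest after
its first edge. -/
structure IsLightestSeq (x : E ⊕ ι) (k : ℕ) (c : ℕ → E) : Prop where
  pos : 0 < k
  dist_origin : ∀ i < k, m.dist (m.origin (c i)) (m.vertexAt x) + i = k
  vertexAt_nextAt : ∀ i < k, m.vertexAt (nextAt x k c i) = m.terminus (c i)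
  not_isCloser : ∀ i < k, ∀ n,
    (∀ j ≤ n, (m.turn ^ j) (m.light (.inl (c i))) ≠ nextAt x k c i) →
    ∀ f, (m.turn ^ n) (m.light (.inl (c i))) = .inl f → ¬ m.IsCloser (m.vertexAt x) f

theorem IsLightest.isLightestSeq {x y : E ⊕ ι} {k : ℕ} {c : ℕ → E} (hk : 0 < k)
    (h : m.IsLightest (m.vertexAt x) y ((List.range k).map c)) : m.IsLightestSeq x k c := by
  let s : ℕ → E ⊕ ι := fun i => Nat.casesOn i y (fun i => m.light (.inl (c i)))
  obtain ⟨hstep, hend⟩ := (isLightest_map_range_iff (s := s) (fun _ => rfl)).1 h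
  have hcloser : ∀ i < k, m.dist (m.terminus (c i)) (m.vertexAt x) + 1 =
    m.dist (m.origin (c i)) (m.vertexAt x) := fun i hi => (hstep i hi).2
  have hlast : m.terminus (c (k - 1)) = m.vertexAt x := by
    obtain ⟨k, rfl⟩ := Nat.exists_eq_succ_of_ne_zero hk.ne'
    exact hend
  have hnext : ∀ i < k, m.vertexAt (nextAt x k c i) = m.terminus (c i) := by
    intro i hi
    unfold nextAt
    split_ifs with hi'
    · obtain ⟨n, hn, -⟩ := (hstep (i + 1) hi').1
      rw [← hn, vertexAt_turn_pow]; rfl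
    · rw [← hlast, show i = k - 1 by omega]
  have hterm : ∀ i, i + 1 < k → m.terminus (c i) = m.origin (c (i + 1)) := by
    intro i hi
    rw [← hnext i (by omega), nextAt, if_pos hi]; rfl
  have hdist : ∀ j, ∀ i, i + j + 1 = k → m.dist (m.origin (c i)) (m.vertexAt x) + i = k := by
    intro j
    induction j with
    | zero =>
      intro i hi
      rw [← hcloser i (by omega), show i = k - 1 by omega, hlast, dist_self]
      omega
    | succ j ih =>
      intro i hi
      rw [← hcloser i (by omega), hterm i (by omega)]
      have := ih (i + 1) (by omega)
      omega
  refine ⟨hk, fun i hi => hdist (k - 1 - i) i (by omega), hnext, fun i hi n hn f hf hc => ?_⟩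
  by_cases hi' : i + 1 < k
  · obtain ⟨n', hn', hmin⟩ := (hstep (i + 1) hi').1
    rcases lt_or_ge n n' with hlt | hge
    · exact hmin n hlt f hf hc
    · exact hn n' hge (by rw [nextAt, if_pos hi']; exact hn')
  -- At the exit vertex the distance is zero, so no edge starting there goes closer.
  · have h0 : m.origin f = m.vertexAt x := by
      rw [origin, ← hf, vertexAt_turn_pow, ← hlast, show i = k - 1 by omega]; rfl
    rw [IsCloser, h0, dist_self] at hc
    omega

/-! ### Elements beside the path, and the potential -/

/-- The elements met on the light side of a path between its incoming and outgoing edges. -/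
def IsBeside (m : ShadedMap E ι) (x : E ⊕ ι) (k : ℕ) (c : ℕ → E) (y : E ⊕ ι) : Prop :=
  ∃ i < k, ∃ n, (m.turn ^ n) (m.light (.inl (c i))) = y ∧
    ∀ j ≤ n, (m.turn ^ j) (m.light (.inl (c i))) ≠ nextAt x k c i

open Classical in
/-- The first element met on the light side of a path after its edge `c i`, or `c i` itself when
there is nothing before the next edge. -/
def besideStart (m : ShadedMap E ι) (x : E ⊕ ι) (k : ℕ) (c : ℕ → E) (i : ℕ) : E ⊕ ι :=
  if m.light (.inl (c i)) = nextAt x k c i then .inl (c i) else m.light (.inl (c i))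

/-- A lower bound for the distance from the new corner in the new map. -/
def potential (m : ShadedMap E ι) (x : E ⊕ ι) (k : ℕ) (c : ℕ → E) (y : E ⊕ ι) : ℤ :=
  open Classical in
  k - m.dist (m.vertexAt y) (m.vertexAt x) - if m.IsBeside x k c y then 1 else 0

namespace IsLightestSeq

variable {x : E ⊕ ι} {k : ℕ} {c : ℕ → E} (h : m.IsLightestSeq x k c)
include h

theorem dist_terminus {i : ℕ} (hi : i < k) :
    m.dist (m.terminus (c i)) (m.vertexAt x) + (i + 1) = k := by
  rw [← h.vertexAt_nextAt i hi]
  unfold nextAt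
  split_ifs with hi'
  · exact h.dist_origin _ hi'
  · rw [dist_self]; omega

theorem isCloser {i : ℕ} (hi : i < k) : m.IsCloser (m.vertexAt x) (c i) := by
  have h1 := h.dist_origin i hi
  have h2 := h.dist_terminus hi
  unfold IsCloser
  omega

theorem dist_nextAt {i : ℕ} (hi : i < k) :
    m.dist (m.vertexAt (nextAt x k c i)) (m.vertexAt x) + (i + 1) = k := by
  rw [h.vertexAt_nextAt i hi]
  exact h.dist_terminus hi

/-- The index of an edge can be read off the distance from its origin to the exit; the same argument
excludes the other coincidences below. -/
theorem injective {i j : ℕ} (hi : i < k) (hj : j < k) (hij : c i = c j) : i = j := by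
  have h1 := h.dist_origin i hi
  have h2 := h.dist_origin j hj
  rw [hij] at h1
  omega

theorem ne_inl {i : ℕ} (hi : i < k) : x ≠ .inl (c i) := by
  intro hx
  have h1 := h.dist_origin i hi
  rw [origin, ← hx, dist_self] at h1
  omega

theorem light_ne_inl_zero {i : ℕ} (hi : i < k) : m.light (.inl (c i)) ≠ .inl (c 0) := by
  intro hx
  have h1 := h.dist_terminus hi
  have h2 := h.dist_origin 0 h.pos
  rw [terminus, hx] at h1
  rw [origin] at h2
  omega

theorem nextAt_ne_inl_zero {i : ℕ} (hi : i < k) : nextAt x k c i ≠ .inl (c 0) := by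
  intro hx
  have h1 := h.dist_nextAt hi
  have h2 := h.dist_origin 0 h.pos
  rw [hx] at h1
  rw [origin] at h2
  omega

theorem nextAt_eq_of_light_eq_inl {i j : ℕ} (hi : i < k) (hj : j < k)
    (hij : m.light (.inl (c i)) = .inl (c j)) : j = i + 1 ∧ nextAt x k c i = .inl (c j) := by
  have h1 := h.dist_terminus hi
  have h2 := h.dist_origin j hj
  rw [terminus, hij] at h1
  rw [origin] at h2
  have : j = i + 1 := by omega
  subst this
  exact ⟨rfl, if_pos hj⟩

theorem nextAt_eq_of_light_eq {i : ℕ} (hi : i < k) (hix : m.light (.inl (c i)) = x) :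
    i + 1 = k ∧ nextAt x k c i = x := by
  have h1 := h.dist_terminus hi
  rw [terminus, hix, dist_self] at h1
  exact ⟨by omega, if_neg (by omega)⟩

theorem dist_of_isBeside {y : E ⊕ ι} (hy : m.IsBeside x k c y) :
    m.dist (m.vertexAt y) (m.vertexAt x) < k := by
  obtain ⟨i, hi, n, rfl, -⟩ := hy
  rw [vertexAt_turn_pow]
  have := h.dist_terminus hi
  rw [terminus] at this
  omega

/-- This is where lightness enters: the edges beside the path come before the chosen one when
turning. -/
theorem not_isCloser_of_isBeside {f : E} (hf : m.IsBeside x k c (.inl f)) :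
    ¬ m.IsCloser (m.vertexAt x) f := by
  obtain ⟨i, hi, n, hn, hmin⟩ := hf
  exact h.not_isCloser i hi n hmin f hn

theorem not_isBeside_inl {i : ℕ} (hi : i < k) : ¬ m.IsBeside x k c (.inl (c i)) :=
  fun hf => h.not_isCloser_of_isBeside hf (h.isCloser hi)

theorem exists_pow_eq_nextAt [Finite E] [Finite ι] {i : ℕ} (hi : i < k) :
    ∃ n : ℕ, (m.turn ^ n) (m.light (.inl (c i))) = nextAt x k c i ∧
      ∀ j < n, (m.turn ^ j) (m.light (.inl (c i))) ≠ nextAt x k c i :=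
  exists_minimal_pow (m.vertexAt_eq_iff.1 (h.vertexAt_nextAt i hi).symm)

/-- Turning from this element leads to the light successor of `c i`. If it were met before `nextAt`,
a whole turn around the vertex would have missed `nextAt`. -/
theorem not_isBeside_darkExt [Finite E] [Finite ι] {i : ℕ} (hi : i < k) :
    ¬ m.IsBeside x k c (m.darkExt (.inl (c i))) := by
  rintro ⟨i', hi', n, hn, hmin⟩
  have hii : i' = i := by
    have h1 := h.dist_terminus hi
    have h2 := h.dist_terminus hi'
    rw [terminus, ← vertexAt_darkExt, ← hn, vertexAt_turn_pow] at h1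
    rw [terminus] at h2
    omega
  subst hii
  obtain ⟨q, hq, -⟩ := h.exists_pow_eq_nextAt hi
  have hper : (m.turn ^ (n + 1)) (m.light (.inl (c i'))) = m.light (.inl (c i')) := by
    rw [pow_succ', mul_apply, hn, turn_darkExt]
  have hmul : (m.turn ^ ((n + 1) * (q / (n + 1)))) (m.light (.inl (c i'))) =
      m.light (.inl (c i')) := by
    rw [pow_mul]
    exact pow_apply_eq_self_of_apply_eq_self hper _
  rw [← Nat.mod_add_div q (n + 1), pow_add, mul_apply, hmul] at hq
  exact hmin _ (Nat.le_of_lt_succ (Nat.mod_lt q (by omega))) hq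

omit h in
/-- Turning by one step, an element stays beside the path unless one crosses the path. -/
theorem isBeside_turn_iff {y : E ⊕ ι} (hn : ∀ i < k, m.turn y ≠ nextAt x k c i)
    (hd : ∀ i < k, y ≠ m.darkExt (.inl (c i))) :
    m.IsBeside x k c (m.turn y) ↔ m.IsBeside x k c y := by
  constructor
  · rintro ⟨i, hi, n, hn', hmin⟩
    cases n with
    | zero =>
      refine absurd (m.turn.injective ?_) (hd i hi)
      rw [turn_darkExt, ← hn']; rfl
    | succ n =>
      rw [pow_succ', mul_apply] at hn'
      exact ⟨i, hi, n, m.turn.injective hn', fun j hj => hmin j (by omega)⟩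
  · rintro ⟨i, hi, n, rfl, hmin⟩
    refine ⟨i, hi, n + 1, by rw [pow_succ', mul_apply], fun j hj => ?_⟩
    rcases hj.lt_or_eq with hj | rfl
    · exact hmin j (by omega)
    · rw [pow_succ', mul_apply]
      exact hn i hi

theorem isBeside_of_turn_eq_nextAt [Finite E] [Finite ι] {y : E ⊕ ι} {i : ℕ} (hi : i < k)
    (hy : m.turn y = nextAt x k c i) (hd : y ≠ m.darkExt (.inl (c i))) :
    m.IsBeside x k c y := by
  obtain ⟨n, hn, hmin⟩ := h.exists_pow_eq_nextAt hi
  cases n with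
  | zero =>
    refine absurd (m.turn.injective ?_) hd
    rw [turn_darkExt, hy, ← hn]; rfl
  | succ n =>
    rw [pow_succ', mul_apply, ← hy] at hn
    exact ⟨i, hi, n, m.turn.injective hn, fun j hj => hmin j (by omega)⟩

theorem nodup : (((List.range k).map c).map (Sum.inl : E → E ⊕ ι)).Nodup := by
  refine List.Nodup.map Sum.inl_injective (List.Nodup.map_on ?_ List.nodup_range)
  intro i hi j hj hij
  exact h.injective (List.mem_range.1 hi) (List.mem_range.1 hj) hij

theorem potential_inl {i : ℕ} (hi : i < k) : potential m x k c (.inl (c i)) = i := by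
  have h1 := h.dist_origin i hi
  rw [origin] at h1
  rw [potential, if_neg (h.not_isBeside_inl hi)]
  omega

theorem potential_darkExt_inl [Finite E] [Finite ι] {i : ℕ} (hi : i < k) :
    potential m x k c (m.darkExt (.inl (c i))) = i + 1 := by
  have h1 := h.dist_terminus hi
  rw [potential, if_neg (h.not_isBeside_darkExt hi), vertexAt_darkExt]
  rw [terminus] at h1
  omega

omit h in
theorem isBeside_light {i : ℕ} (hi : i < k) (hn : m.light (.inl (c i)) ≠ nextAt x k c i) :
    m.IsBeside x k c (m.light (.inl (c i))) :=
  ⟨i, hi, 0, rfl, fun j hj => by rw [Nat.le_zero.1 hj]; exact hn⟩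

/-- The element beside the end of `c i` is one step nearer to the exit than `c i`, and the
correction compensates: the light copy of a vertex has the value of the dark copy of the previous
one, to which it gets glued. -/
theorem potential_besideStart {i : ℕ} (hi : i < k) :
    potential m x k c (m.besideStart x k c i) = i := by
  unfold besideStart
  split_ifs with hn
  · exact h.potential_inl hi
  · have h1 := h.dist_terminus hi
    rw [terminus] at h1
    rw [potential, if_pos (isBeside_light hi hn)]
    omega

theorem potential_exit : potential m x k c x = k := by
  have hk := h.pos
  have hx : ¬ m.IsBeside x k c x := by
    rintro ⟨i, hi, n, hn, hmin⟩
    have h1 := h.dist_terminus hi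
    rw [terminus, ← vertexAt_turn_pow _ n, hn, dist_self] at h1
    refine hmin n le_rfl ?_
    rw [hn, nextAt, if_neg (by omega)]
  rw [potential, if_neg hx, dist_self]
  simp

end IsLightestSeq

/-! ### The map obtained by slit-slide-sew -/

variable [DecidableEq E] [DecidableEq ι]

/-- Slit-slide-sew along the path with edges `c 0, …, c (k - 1)`. -/
def slid (m : ShadedMap E ι) (x : E ⊕ ι) (k : ℕ) (c : ℕ → E) : ShadedMap E ι where
  light := (matching ((List.range k).map c))⁻¹ * slidLight m (c 0) x *
    matching ((List.range k).map c)
  dark := m.dark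

namespace IsLightestSeq

variable {x : E ⊕ ι} {k : ℕ} {c : ℕ → E} (h : m.IsLightestSeq x k c)
include h

theorem matching_inl {i : ℕ} (hi : i + 1 < k) :
    matching (ι := ι) ((List.range k).map c) (.inl (c i)) = .inl (c (i + 1)) := by
  have := List.formPerm_apply_lt_getElem _ h.nodup i (by simpa using hi)
  simpa [matching] using this

theorem matching_inl_last :
    matching (ι := ι) ((List.range k).map c) (.inl (c (k - 1))) = .inl (c 0) := by
  have hk := h.pos
  have := List.formPerm_apply_getElem _ h.nodup (k - 1) (by simpa using hk)
  simpa [matching, Nat.sub_add_cancel hk] using this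

omit h in
theorem matching_of_ne {y : E ⊕ ι} (hy : ∀ i < k, y ≠ .inl (c i)) :
    matching ((List.range k).map c) y = y := by
  refine List.formPerm_apply_of_notMem ?_
  simp only [List.mem_map, List.mem_range, not_exists, not_and]
  rintro _ ⟨i, hi, rfl⟩ rfl
  exact hy i hi rfl

/-- If the light side of `c i` is directly followed by the next side of the path, or by the exit
where the new side is inserted, that follower is renamed `c i` after its dark side. This explains
the first case of `besideStart`. -/
theorem matching_inv_swap_light {i : ℕ} (hi : i < k) :
    (matching ((List.range k).map c))⁻¹ (swap (.inl (c 0)) x (m.light (.inl (c i)))) =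
      m.besideStart x k c i := by
  rw [inv_eq_iff_eq]
  by_cases hx : m.light (.inl (c i)) = x
  · obtain ⟨hik, hn⟩ := h.nextAt_eq_of_light_eq hi hx
    rw [hx, swap_apply_right, besideStart, if_pos (by rw [hn, hx]),
      show i = k - 1 by omega, h.matching_inl_last]
  rw [swap_apply_of_ne_of_ne (h.light_ne_inl_zero hi) hx, besideStart]
  split_ifs with hn
  · have hik : i + 1 < k := by
      by_contra hik
      exact hx (by rw [hn, nextAt, if_neg hik])
    rw [h.matching_inl hik, hn, nextAt, if_pos hik]
  · refine (matching_of_ne fun j hj hij => hn ?_).symm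
    rw [(h.nextAt_eq_of_light_eq_inl hi hj hij).2, hij]

omit h in
theorem slid_light_apply (z : E ⊕ ι) : (m.slid x k c).light z =
    (matching ((List.range k).map c))⁻¹ (swap (.inl (c 0)) x
      (swap (.inl (c 0)) (m.light (.inl (c 0)))
        (m.light (matching ((List.range k).map c) z)))) := rfl

theorem slid_light_inl {i : ℕ} (hi : i + 1 < k) :
    (m.slid x k c).light (.inl (c i)) = m.besideStart x k c (i + 1) := by
  rw [slid_light_apply, h.matching_inl hi,
    swap_apply_of_ne_of_ne (h.light_ne_inl_zero hi), h.matching_inv_swap_light hi]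
  intro he
  have := h.injective hi h.pos (Sum.inl_injective (m.light.injective he))
  omega

theorem slid_light_inl_last : (m.slid x k c).light (.inl (c (k - 1))) = x := by
  rw [slid_light_apply, h.matching_inl_last, swap_apply_right, swap_apply_left, inv_eq_iff_eq,
    matching_of_ne fun i hi => h.ne_inl hi]

theorem slid_light_of_light_eq {z : E ⊕ ι} (hz : ∀ i < k, z ≠ .inl (c i))
    (hl : m.light z = .inl (c 0)) : (m.slid x k c).light z = m.besideStart x k c 0 := by
  rw [slid_light_apply, matching_of_ne hz, hl, swap_apply_left,
    h.matching_inv_swap_light h.pos]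

theorem slid_light_of_light_eq_nextAt {z : E ⊕ ι} (hz : ∀ i < k, z ≠ .inl (c i)) {i : ℕ}
    (hi : i < k) (hl : m.light z = nextAt x k c i) :
    (m.slid x k c).light z = .inl (c i) := by
  have hne : m.light z ≠ m.light (.inl (c 0)) := fun he => hz 0 h.pos (m.light.injective he)
  rw [slid_light_apply, matching_of_ne hz,
    swap_apply_of_ne_of_ne (by rw [hl]; exact h.nextAt_ne_inl_zero hi) hne, inv_eq_iff_eq, hl,
    nextAt]
  split_ifs with hik
  · rw [h.matching_inl hik, swap_apply_of_ne_of_ne]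
    · intro he
      have := h.injective hik h.pos (Sum.inl_injective he)
      omega
    · exact (h.ne_inl hik).symm
  · rw [swap_apply_right, show i = k - 1 by omega, h.matching_inl_last]

theorem slid_light_of_ne {z : E ⊕ ι} (hz : ∀ i < k, z ≠ .inl (c i))
    (h0 : m.light z ≠ .inl (c 0)) (hn : ∀ i < k, m.light z ≠ nextAt x k c i) :
    (m.slid x k c).light z = m.light z := by
  have hne : m.light z ≠ m.light (.inl (c 0)) := fun he => hz 0 h.pos (m.light.injective he)
  have hk := h.pos
  have hx : m.light z ≠ x := by
    have := hn (k - 1) (by omega)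
    rwa [nextAt, if_neg (by omega)] at this
  rw [slid_light_apply, matching_of_ne hz, swap_apply_of_ne_of_ne h0 hne,
    swap_apply_of_ne_of_ne h0 hx, inv_eq_iff_eq, matching_of_ne]
  intro i hi
  cases i with
  | zero => exact h0
  | succ i =>
    have := hn i (by omega)
    rwa [nextAt, if_pos hi] at this

omit h in
theorem slid_turn_darkExt (z : E ⊕ ι) :
    (m.slid x k c).turn (m.darkExt z) = (m.slid x k c).light z :=
  (m.slid x k c).turn_darkExt z

/-- The potential is a function of the vertices of the new map. -/
theorem potential_slid_turn [Finite E] [Finite ι] (y : E ⊕ ι) :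
    potential m x k c ((m.slid x k c).turn y) = potential m x k c y := by
  obtain ⟨z, rfl⟩ := m.darkExt.surjective y
  rw [slid_turn_darkExt]
  by_cases hz : ∃ i < k, z = .inl (c i)
  · obtain ⟨i, hi, rfl⟩ := hz
    rw [h.potential_darkExt_inl hi]
    by_cases hik : i + 1 < k
    · rw [h.slid_light_inl hik, h.potential_besideStart hik]
      push_cast; rfl
    · obtain rfl : i = k - 1 := by omega
      rw [h.slid_light_inl_last, h.potential_exit]
      have := h.pos
      omega
  replace hz : ∀ i < k, z ≠ .inl (c i) := fun i hi he => hz ⟨i, hi, he⟩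
  have hd : ∀ i < k, m.darkExt z ≠ m.darkExt (.inl (c i)) :=
    fun i hi he => hz i hi (m.darkExt.injective he)
  -- The corner of the removed edge is at distance `k` from the exit, farther than anything beside
  -- the path, so its potential is zero.
  by_cases h0 : m.light z = .inl (c 0)
  · have h1 := h.dist_origin 0 h.pos
    rw [origin, ← h0, ← vertexAt_darkExt] at h1
    have h2 : ¬ m.IsBeside x k c (m.darkExt z) := fun hb => by
      have := h.dist_of_isBeside hb
      omega
    rw [h.slid_light_of_light_eq hz h0, h.potential_besideStart h.pos, potential, if_neg h2]
    omega
  -- The element met just before `nextAt` is beside the path, so its potential is `k - (k - (i + 1))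
  -- - 1 = i`.
  by_cases hn : ∃ i < k, m.light z = nextAt x k c i
  · obtain ⟨i, hi, hl⟩ := hn
    have h1 := h.dist_nextAt hi
    have h2 := h.isBeside_of_turn_eq_nextAt hi (by rw [turn_darkExt, hl]) (hd i hi)
    rw [h.slid_light_of_light_eq_nextAt hz hi hl, h.potential_inl hi, potential, if_pos h2,
      vertexAt_darkExt, hl]
    omega
  replace hn : ∀ i < k, m.light z ≠ nextAt x k c i := fun i hi he => hn ⟨i, hi, he⟩
  have hb := isBeside_turn_iff (by simpa only [turn_darkExt] using hn) hd
  rw [h.slid_light_of_ne hz h0 hn, ← turn_darkExt, potential, potential, vertexAt_turn]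
  by_cases hb' : m.IsBeside x k c (m.turn (m.darkExt z))
  · rw [if_pos hb', if_pos (hb.1 hb')]
  · rw [if_neg hb', if_neg fun h' => hb' (hb.2 h')]

/-- Turning around the vertices of the new map, beside the path. -/
theorem slid_turn_of_isBeside [Finite E] [Finite ι] {y : E ⊕ ι} (hy : m.IsBeside x k c y)
    (hn : ∀ i < k, m.turn y ≠ nextAt x k c i) : (m.slid x k c).turn y = m.turn y := by
  obtain ⟨z, rfl⟩ := m.darkExt.surjective y
  rw [turn_darkExt] at hn
  rw [slid_turn_darkExt, turn_darkExt]
  refine h.slid_light_of_ne ?_ ?_ hn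
  · rintro i hi rfl
    exact h.not_isBeside_darkExt hi hy
  · intro h0
    have h1 := h.dist_of_isBeside hy
    have h2 := h.dist_origin 0 h.pos
    rw [vertexAt_darkExt, h0] at h1
    rw [origin] at h2
    omega

theorem slid_turn_of_isBeside_of_eq [Finite E] [Finite ι] {y : E ⊕ ι}
    (hy : m.IsBeside x k c y) {i : ℕ} (hi : i < k) (hn : m.turn y = nextAt x k c i) :
    (m.slid x k c).turn y = .inl (c i) := by
  obtain ⟨z, rfl⟩ := m.darkExt.surjective y
  rw [turn_darkExt] at hn
  rw [slid_turn_darkExt]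
  refine h.slid_light_of_light_eq_nextAt ?_ hi hn
  rintro i hi rfl
  exact h.not_isBeside_darkExt hi hy

/-- The elements beside the end of `c i` keep their cyclic order but are now followed by `c i`: they
have been transferred to its origin. The order also serves to prove lightness of the reversed path.
-/
theorem exists_slid_turn_pow [Finite E] [Finite ι] {i : ℕ} (hi : i < k) :
    ∃ n : ℕ, ((m.slid x k c).turn ^ n) (m.besideStart x k c i) = .inl (c i) ∧
      ∀ j < n, m.IsBeside x k c (((m.slid x k c).turn ^ j) (m.besideStart x k c i)) := by
  obtain ⟨n, hn, hmin⟩ := h.exists_pow_eq_nextAt hi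
  unfold besideStart
  cases n with
  | zero => exact ⟨0, if_pos hn, fun j hj => absurd hj (Nat.not_lt_zero j)⟩
  | succ n =>
    rw [if_neg (show m.light (.inl (c i)) ≠ _ from hmin 0 (by omega))]
    have hb : ∀ j < n + 1, m.IsBeside x k c ((m.turn ^ j) (m.light (.inl (c i)))) :=
      fun j hj => ⟨i, hi, j, rfl, fun j' hj' => hmin j' (by omega)⟩
    have hpow : ∀ j < n + 1, ((m.slid x k c).turn ^ j) (m.light (.inl (c i))) =
        (m.turn ^ j) (m.light (.inl (c i))) := by
      intro j hj
      refine pow_eq_pow_of_eq_on (n := n) (fun l hl => ?_) (by omega)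
      rw [pow_succ', mul_apply]
      refine h.slid_turn_of_isBeside (hb l (by omega)) fun i' hi' he => ?_
      -- Exits of distinct indices are at distinct distances from the exit vertex, hence at distinct
      -- vertices.
      have hii : i' = i := by
        have h1 := h.dist_nextAt hi'
        have h2 := h.dist_terminus hi
        rw [← he, vertexAt_turn, vertexAt_turn_pow] at h1
        rw [terminus] at h2
        omega
      subst hii
      refine hmin (l + 1) (by omega) ?_
      rw [pow_succ', mul_apply, he]
    refine ⟨n + 1, ?_, fun j hj => by rw [hpow j hj]; exact hb j hj⟩
    rw [pow_succ', mul_apply, hpow n (by omega)]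
    refine h.slid_turn_of_isBeside_of_eq (hb n (by omega)) hi ?_
    rw [← mul_apply, ← pow_succ', hn]

/-! ### Distances from the new corner -/

theorem slid_vertexAt_besideStart [Finite E] [Finite ι] {i : ℕ} (hi : i < k) :
    (m.slid x k c).vertexAt (m.besideStart x k c i) = (m.slid x k c).origin (c i) := by
  obtain ⟨n, hn, -⟩ := h.exists_slid_turn_pow hi
  rw [origin, ← hn, vertexAt_turn_pow]

theorem slid_terminus [Finite E] [Finite ι] {i : ℕ} (hi : i + 1 < k) :
    (m.slid x k c).terminus (c i) = (m.slid x k c).origin (c (i + 1)) := by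
  rw [terminus, h.slid_light_inl hi, h.slid_vertexAt_besideStart hi]

theorem slid_isPath [Finite E] [Finite ι] {i : ℕ} (hi : i < k) :
    (m.slid x k c).IsPath ((m.slid x k c).origin (c 0)) ((List.range i).map c)
      ((m.slid x k c).origin (c i)) := by
  induction i with
  | zero => rfl
  | succ i ih =>
    rw [List.range_succ, List.map_append, isPath_append]
    exact ⟨_, ih (by omega), rfl, h.slid_terminus hi⟩

theorem exists_potential_vertex [Finite E] [Finite ι] :
    ∃ g : (m.slid x k c).Vertex → ℤ,
      ∀ y, g ((m.slid x k c).vertexAt y) = potential m x k c y :=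
  ⟨Quotient.lift (potential m x k c) fun _ _ hs => rel_of_sameCycle
    (r := fun y z => potential m x k c y = potential m x k c z)
    ⟨fun _ => rfl, Eq.symm, Eq.trans⟩ (fun y => (h.potential_slid_turn y).symm) hs,
    fun _ => rfl⟩

theorem potential_slid_light [Finite E] [Finite ι] (z : E ⊕ ι) :
    potential m x k c ((m.slid x k c).light z) = potential m x k c (m.darkExt z) := by
  rw [← slid_turn_darkExt, h.potential_slid_turn]

/-- The old distance to the exit drops by at most one along `f`, and does not drop if `f` starts
beside the path, which pays for the correction at its origin. A correction at its end saves one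
more. -/
theorem potential_slid_light_le [Finite E] [Finite ι] (hm : m.IsStronglyConnected) (f : E) :
    potential m x k c ((m.slid x k c).light (.inl f)) ≤ potential m x k c (.inl f) +
      open Classical in if m.IsBeside x k c (m.darkExt (.inl f)) then 0 else 1 := by
  rw [h.potential_slid_light]
  have h1 : m.dist (m.vertexAt (.inl f)) (m.vertexAt x) ≤
      m.dist (m.vertexAt (m.light (.inl f))) (m.vertexAt x) + 1 := hm.dist_origin_le f _
  have h2 : m.IsBeside x k c (.inl f) → m.dist (m.vertexAt (.inl f)) (m.vertexAt x) ≠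
      m.dist (m.vertexAt (m.light (.inl f))) (m.vertexAt x) + 1 :=
    fun hf he => h.not_isCloser_of_isBeside hf he.symm
  rw [potential, potential, vertexAt_darkExt]
  split_ifs with h3 h4 h4
  · have := h2 h4; omega
  · omega
  · have := h2 h4; omega
  · omega

theorem potential_le_dist [Finite E] [Finite ι] (hm : m.IsStronglyConnected)
    (hs : (m.slid x k c).IsStronglyConnected) (y : E ⊕ ι) : potential m x k c y ≤
      (m.slid x k c).dist ((m.slid x k c).origin (c 0)) ((m.slid x k c).vertexAt y) := by
  obtain ⟨g, hg⟩ := h.exists_potential_vertex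
  have := hs.le_add_dist g (fun e => ?_) ((m.slid x k c).origin (c 0))
    ((m.slid x k c).vertexAt y)
  · rw [show g ((m.slid x k c).origin (c 0)) = _ from hg _, hg, h.potential_inl h.pos] at this
    simpa using this
  · rw [origin, terminus, hg, hg]
    refine (h.potential_slid_light_le hm e).trans ?_
    split_ifs <;> omega

/-- The path gives the upper bound and the potential the lower one. -/
theorem slid_dist_origin [Finite E] [Finite ι] (hm : m.IsStronglyConnected)
    (hs : (m.slid x k c).IsStronglyConnected) {i : ℕ} (hi : i < k) :
    (m.slid x k c).dist ((m.slid x k c).origin (c 0)) ((m.slid x k c).origin (c i)) = i := by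
  have h1 := dist_le_of_isPath (h.slid_isPath hi)
  have h2 := h.potential_le_dist hm hs (.inl (c i))
  rw [List.length_map, List.length_range] at h1
  rw [h.potential_inl hi] at h2
  exact le_antisymm h1 (by exact_mod_cast h2)

theorem slid_dist_terminus [Finite E] [Finite ι] (hm : m.IsStronglyConnected)
    (hs : (m.slid x k c).IsStronglyConnected) {i : ℕ} (hi : i < k) :
    (m.slid x k c).dist ((m.slid x k c).origin (c 0)) ((m.slid x k c).terminus (c i)) =
      i + 1 := by
  have h1 := dist_le_of_isPath (γ := (List.range i).map c ++ [c i])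
    (isPath_append _ |>.2 ⟨_, h.slid_isPath hi, rfl, rfl⟩)
  have h2 := h.potential_le_dist hm hs ((m.slid x k c).light (.inl (c i)))
  rw [List.length_append, List.length_map, List.length_range, List.length_singleton] at h1
  rw [h.potential_slid_light, h.potential_darkExt_inl hi] at h2
  exact le_antisymm h1 (by exact_mod_cast h2)

/-- Backward, the path is the lightest geodesic of the new map. -/
theorem slid_reverse_isLightest [Finite E] [Finite ι] (hm : m.IsStronglyConnected)
    (hs : (m.slid x k c).IsStronglyConnected) {w : (m.slid x k c).reverse.Vertex}
    (hw : (m.slid x k c).reverseVertex w = (m.slid x k c).origin (c 0)) :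
    (m.slid x k c).reverse.IsLightest w (.inl (c (k - 1)))
      ((List.range k).map fun i => c (k - 1 - i)) := by
  have hk := h.pos
  let s : ℕ → E ⊕ ι := fun i =>
    Nat.casesOn i (.inl (c (k - 1))) fun i => (m.slid x k c).light⁻¹ (.inl (c (k - 1 - i)))
  refine (isLightest_map_range_iff (s := s) fun _ => rfl).2 ⟨fun i hi => ⟨?_, ?_⟩, ?_⟩
  · cases i with
    | zero => exact ⟨0, rfl, fun j hj => absurd hj (Nat.not_lt_zero j)⟩
    | succ i =>
      have hik : k - 1 - (i + 1) + 1 = k - 1 - i := by omega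
      -- In the reversed map the rotation is run backward: from `c (k - 1 - i)` it goes through
      -- elements beside the old path, down to `besideStart`, which follows the next edge of the
      -- reversed path.
      obtain ⟨n, hn, hb⟩ := h.exists_slid_turn_pow (i := k - 1 - i) (by omega)
      have hlight : ∀ j, (m.slid x k c).light (((m.slid x k c).reverse.turn ^ j) (s (i + 1))) =
          ((m.slid x k c).turn⁻¹ ^ j) (.inl (c (k - 1 - i))) := by
        intro j
        rw [light_reverse_turn_pow]
        congr 1
        exact (m.slid x k c).light.apply_symm_apply _
      have hback : ∀ j ≤ n, ((m.slid x k c).turn⁻¹ ^ j) (.inl (c (k - 1 - i))) =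
          ((m.slid x k c).turn ^ (n - j)) (m.besideStart x k c (k - 1 - i)) := by
        intro j hj
        rw [← hn, inv_pow, inv_eq_iff_eq, ← mul_apply, ← pow_add, Nat.add_sub_cancel' hj]
      refine ⟨n, (m.slid x k c).light.injective ?_, fun j hj f hf hc => ?_⟩
      · rw [hlight, hback n le_rfl, Nat.sub_self, h.slid_light_inl (by omega), hik]
        rfl
      · have h1 := hlight j
        rw [hf] at h1
        have h2 : m.IsBeside x k c (m.darkExt (.inl f)) := by
          have h3 := hb (n - j - 1) (by omega)
          rw [hback j hj.le, show n - j = n - j - 1 + 1 by omega, pow_succ', mul_apply,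
            ← slid_turn_darkExt] at h1
          rwa [(m.slid x k c).turn.injective h1]
        have h3 : (m.slid x k c).terminus f = (m.slid x k c).origin (c (k - 1 - i)) := by
          rw [terminus, h1, origin, hback j hj.le, vertexAt_turn_pow, ← hn, vertexAt_turn_pow]
        -- The potential does not increase along `f`, so the origin of `f` is at distance at least
        -- `k - 1 - i` from the new corner, and `f` cannot be leaving it.
        have h4 := h.potential_slid_light_le hm f
        obtain ⟨g, hg⟩ := h.exists_potential_vertex
        rw [if_pos h2, ← hg, show (m.slid x k c).vertexAt _ = _ from h3, origin, hg,
          h.potential_inl (by omega)] at h4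
        have h5 := h.potential_le_dist hm hs (.inl f)
        rw [isCloser_reverse_iff, hw, IsLeaving, h3,
          h.slid_dist_origin hm hs (by omega)] at hc
        rw [← origin] at h5
        omega
  · rw [isCloser_reverse_iff, hw, IsLeaving, h.slid_dist_origin hm hs (by omega),
      h.slid_dist_terminus hm hs (by omega)]
  · refine (m.slid x k c).reverseVertex.injective ?_
    rw [hw, reverseVertex_vertexAt, origin]
    obtain ⟨k, rfl⟩ := Nat.exists_eq_succ_of_ne_zero hk.ne'
    congr 1
    refine ((m.slid x (k + 1) c).light.apply_symm_apply _).trans ?_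
    simp

end IsLightestSeq

end ShadedMap

namespace ShadedMap

open Equiv Equiv.Perm

variable {E ι : Type} {m : ShadedMap E ι}

/-! ### The lightest geodesic of a configuration as a simple path -/

theorem IsStronglyConnected.exists_isLightestSeq [Finite E] [Finite ι]
    (hm : m.IsStronglyConnected) {x : E ⊕ ι} {e : E} (he : m.IsCloser (m.vertexAt x) e) :
    ∃ (k : ℕ) (c : ℕ → E), c 0 = e ∧
      m.lightestGeodesic (.inl e) (m.vertexAt x) = (List.range (k + 1)).map c ∧
      m.IsLightestSeq x (k + 1) c := by
  have h := hm.isLightest_lightestGeodesic (m.vertexAt x) (.inl e)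
  cases hγ : m.lightestGeodesic (.inl e) (m.vertexAt x) with
  | nil =>
    rw [hγ] at h
    have h0 : m.origin e = m.vertexAt x := h
    rw [IsCloser, h0, dist_self] at he
    omega
  | cons e' γ =>
    rw [hγ] at h
    obtain ⟨n, hn, hmin⟩ := h.1
    -- The search starts at the corner preceding `e`, and `e` itself goes closer, so it is chosen at
    -- once.
    have hn0 : n = 0 := by
      by_contra hn0
      exact hmin 0 (Nat.pos_of_ne_zero hn0) e rfl he
    subst hn0
    obtain rfl : e = e' := Sum.inl_injective hn
    have hlist : e :: γ = (List.range (γ.length + 1)).map fun i => (e :: γ).getD i e := by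
      refine List.ext_getElem (by simp) fun i h1 h2 => ?_
      simp [List.getD_eq_getElem?_getD, List.getElem?_eq_getElem h1]
    refine ⟨γ.length, fun i => (e :: γ).getD i e, rfl, hlist, ?_⟩
    rw [hlist] at h
    exact h.isLightestSeq (Nat.succ_pos _)

theorem IsLightestSeq.isSimplePath {x : E ⊕ ι} {k : ℕ} {c : ℕ → E}
    (h : m.IsLightestSeq x k c) : m.IsSimplePath ((List.range k).map c) x := by
  -- Induction on the length `d` of the final portion of the path.
  have key : ∀ d ≤ k, m.IsSimplePath ((List.range d).map fun i => c (k - d + i)) x := by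
    intro d hd
    induction d with
    | zero => trivial
    | succ d ih =>
      have heq : ∀ i, k - (d + 1) + (i + 1) = k - d + i := fun i => by omega
      have hne : ∀ j < d, m.origin (c (k - d + j)) ≠ m.origin (c (k - (d + 1))) := by
        intro j hj he
        have h1 := h.dist_origin (k - d + j) (by omega)
        have h2 := h.dist_origin (k - (d + 1)) (by omega)
        rw [he] at h1
        omega
      rw [List.range_succ_eq_map, List.map_cons, List.map_map]
      simp only [Function.comp_def, Nat.succ_eq_add_one, heq, add_zero]
      refine ⟨?_, fun hx => ?_, ?_, ih (by omega)⟩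
      · rw [← h.vertexAt_nextAt _ (by omega)]
        congr 1
        cases d with
        | zero => rw [nextAt, if_neg (by omega)]; rfl
        | succ d =>
          rw [nextAt, if_pos (by omega), List.range_succ_eq_map,
            show k - (d + 1 + 1) + 1 = k - (d + 1) by omega]
          rfl
      · have h1 := h.dist_origin (k - (d + 1)) (by omega)
        rw [← hx, dist_self] at h1
        omega
      · simp only [List.mem_map, List.mem_range, forall_exists_index, and_imp,
          forall_apply_eq_imp_iff₂]
        exact hne
  simpa using key k le_rfl

theorem map_range_reverse (c : ℕ → E) (k : ℕ) :
    (List.range k).map (fun i => c (k - 1 - i)) = ((List.range k).map c).reverse := by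
  refine List.ext_getElem (by simp) fun i h1 h2 => ?_
  simp

/-! ### Sliding back along the reversed path -/

variable [DecidableEq E] [DecidableEq ι]

/-- The new corner after slit-slide-sew along the path with edges `c 0, …, c (k - 1)`. -/
def slidCorner (m : ShadedMap E ι) (x : E ⊕ ι) (k : ℕ) (c : ℕ → E) : E ⊕ ι :=
  (matching ((List.range k).map c))⁻¹ (slidLight m (c 0) x (m.light⁻¹ (.inl (c 0))))

theorem slitSlideSew_map_range (x : E ⊕ ι) (k : ℕ) (c : ℕ → E) :
    m.slitSlideSew (c 0) ((List.range k).map (c ∘ Nat.succ)) x = m.slid x (k + 1) c := by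
  rw [slid, List.range_succ_eq_map, List.map_cons, List.map_map]; rfl

theorem newCorner_map_range (x : E ⊕ ι) (k : ℕ) (c : ℕ → E) :
    m.newCorner (c 0) ((List.range k).map (c ∘ Nat.succ)) x = m.slidCorner x (k + 1) c := by
  rw [slidCorner, List.range_succ_eq_map, List.map_cons, List.map_map]; rfl

theorem IsLightestSeq.slidCorner_eq {x : E ⊕ ι} {k : ℕ} {c : ℕ → E}
    (h : m.IsLightestSeq x k c) : m.slidCorner x k c = m.besideStart x k c 0 := by
  rw [← h.matching_inv_swap_light h.pos, slidCorner, slidLight, insertSide, deleteSide]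
  simp

/-- The corner of the reversed new map to which the path is slid back. -/
def slidReverseCorner (m : ShadedMap E ι) (x : E ⊕ ι) (k : ℕ) (c : ℕ → E) : E ⊕ ι :=
  (m.slid x k c).light⁻¹ (m.slidCorner x k c)

theorem matching_slidReverseCorner (x : E ⊕ ι) (k : ℕ) (c : ℕ → E) :
    matching ((List.range k).map c) (m.slidReverseCorner x k c) = m.light⁻¹ (.inl (c 0)) := by
  have : (m.slid x k c).light⁻¹ = (matching ((List.range k).map c))⁻¹ *
      ((slidLight m (c 0) x)⁻¹ * matching ((List.range k).map c)) := by
    rw [slid]; group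
  rw [slidReverseCorner, this, slidCorner]
  simp

theorem matching_reverse (γ : List E) :
    matching (ι := ι) γ.reverse = (matching γ)⁻¹ := by
  rw [matching, List.map_reverse, List.formPerm_reverse, matching]

/-- In the backward contour, the element that used to precede `e` must follow it; deleting `e` and
inserting it there puts the side back in its original place. -/
theorem slidLight_swap_inv (e : E) (x : E ⊕ ι) :
    swap (.inl e) (m.light⁻¹ (.inl e)) * (swap (.inl e) ((slidLight m e x)⁻¹ (.inl e)) *
      (slidLight m e x)⁻¹) = m.light⁻¹ := by
  have hconj : ∀ (σ : Perm (E ⊕ ι)) a b, σ * swap a b = swap (σ a) (σ b) * σ := by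
    intro σ a b
    rw [swap_apply_apply, inv_mul_cancel_right]
  rw [← inv_inj, mul_inv_rev, mul_inv_rev, inv_inv, inv_inv, swap_inv, swap_inv,
    hconj (slidLight m e x)]
  have h1 : slidLight m e x (.inl e) = x := by simp [slidLight, insertSide, deleteSide]
  have h2 : slidLight m e x ((slidLight m e x)⁻¹ (.inl e)) = .inl e :=
    apply_symm_apply _ _
  have h3 : m.light (m.light⁻¹ (.inl e)) = .inl e := apply_symm_apply _ _
  rw [h1, h2, slidLight, insertSide, deleteSide, swap_comm x, swap_mul_self_mul, mul_assoc,
    hconj m.light, h3, swap_comm (m.light _), swap_mul_self_mul]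

namespace IsLightestSeq

variable {x : E ⊕ ι} {k : ℕ} {c : ℕ → E} (h : m.IsLightestSeq x k c)
include h

/-- Sliding back along the reverse path. -/
theorem slidLight_slid_reverse :
    slidLight (m.slid x k c).reverse (c (k - 1)) (m.slidReverseCorner x k c) =
      (matching ((List.range k).map c))⁻¹ * m.light⁻¹ * matching ((List.range k).map c) := by
  have hM := h.matching_inl_last
  have hx := m.matching_slidReverseCorner x k c
  have hl : (m.slid x k c).light⁻¹ = (matching ((List.range k).map c))⁻¹ *
      (slidLight m (c 0) x)⁻¹ * matching ((List.range k).map c) := by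
    rw [slid]; group
  have hconj : ∀ a b : E ⊕ ι, swap a b = (matching ((List.range k).map c))⁻¹ *
      swap (matching ((List.range k).map c) a) (matching ((List.range k).map c) b) *
      matching ((List.range k).map c) := by
    intro a b
    rw [swap_apply_apply]; group
  -- The matching sends `c (k - 1)` to `c 0` and the new corner to the former predecessor of `c 0`,
  -- so conjugation reduces the claim to `slidLight_swap_inv`.
  rw [slidLight, insertSide, deleteSide, reverse, hl, hconj, hconj (.inl (c (k - 1))), hM, hx,
    mul_apply, mul_apply, hM]
  conv_rhs => rw [← slidLight_swap_inv (c 0) x]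
  simp only [← mul_apply, mul_inv_cancel_left, mul_assoc]

/-- The matching of the reversed path is the inverse of the original one, so the two conjugations
cancel. -/
theorem slid_reverse_slid : ((m.slid x k c).reverse.slid (m.slidReverseCorner x k c) k
    fun i => c (k - 1 - i)) = m.reverse := by
  have key : ((m.slid x k c).reverse.slid (m.slidReverseCorner x k c) k
      fun i => c (k - 1 - i)).light = m.reverse.light := by
    rw [slid, map_range_reverse, matching_reverse, Nat.sub_zero,
      h.slidLight_slid_reverse]
    change _ = m.light⁻¹
    simp [mul_assoc]
  exact (ShadedMap.mk.injEq ..).symm ▸ ⟨key, rfl⟩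

theorem slidCorner_slid_reverse : (m.slid x k c).reverse.slidCorner
    (m.slidReverseCorner x k c) k (fun i => c (k - 1 - i)) = m.light⁻¹ x := by
  have hM := h.matching_inl_last
  have hl : (m.slid x k c).light (.inl (c (k - 1))) =
    (matching ((List.range k).map c))⁻¹ (slidLight m (c 0) x (.inl (c 0))) := by
    rw [← hM]; rfl
  rw [slidCorner, map_range_reverse, matching_reverse, Nat.sub_zero,
    h.slidLight_slid_reverse, reverse, inv_inv, inv_inv, hl]
  simp [slidLight, insertSide, deleteSide]

end IsLightestSeq

end ShadedMap

/-! ### Configurations -/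

namespace Config

open ShadedMap

variable {E ι : Type}

/-- The configuration whose map, corner and edge are seen in the orientation `O`, opposite to its
own. -/
def ofReversed (O : EdgeOrientation) (m : ShadedMap E ι) (x : E ⊕ ι) (e : E) : Config E ι :=
  ⟨O.reverse, m.inOrientation O, m.cornerInOrientation x O, e⟩

theorem inOrientation_inOrientation (O : EdgeOrientation) (m : ShadedMap E ι) :
    (m.inOrientation O).inOrientation O = m := by cases O <;> rfl

theorem cornerInOrientation_cornerInOrientation (O : EdgeOrientation) (m : ShadedMap E ι)
    (x : E ⊕ ι) :
    (m.inOrientation O).cornerInOrientation (m.cornerInOrientation x O) O = x := by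
  cases O
  · rfl
  · exact m.light.apply_symm_apply x

theorem ofReversed_inOrientation (q : Config E ι) :
    ofReversed q.orient.reverse (q.map.inOrientation q.orient.reverse)
      (q.map.cornerInOrientation q.corner q.orient.reverse) q.edge = q := by
  rw [ofReversed, inOrientation_inOrientation, cornerInOrientation_cornerInOrientation]
  obtain ⟨O, m, x, e⟩ := q
  cases O <;> rfl

/-- This puts the output of a slide in the same form as its input, so that the slide can be
iterated. -/
theorem mk_inOrientation (O : EdgeOrientation) (m : ShadedMap E ι) (x : E ⊕ ι) (e : E) :
    (⟨O, m.inOrientation O, m.cornerInOrientation x O, e⟩ : Config E ι) =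
      ofReversed O.reverse m.reverse (m.light⁻¹ x) e := by
  cases O
  · have : m.light (m.light⁻¹ x) = x := m.light.apply_symm_apply x
    simp only [ofReversed, EdgeOrientation.reverse, inOrientation, cornerInOrientation,
      ShadedMap.reverse, inv_inv, this]
  · rfl

theorem isHypermap_inOrientation_iff {p : ℕ} {O : EdgeOrientation} {m : ShadedMap E ι} :
    (m.inOrientation O).IsHypermap p ↔ m.IsHypermap p := by
  cases O
  · rfl
  · exact ⟨fun h => h.reverse, fun h => h.reverse⟩

theorem isMarked_inOrientation_iff {O : EdgeOrientation} {m : ShadedMap E ι} :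
    (m.inOrientation O).IsMarked ↔ m.IsMarked := by
  cases O
  · rfl
  · exact ⟨fun h => h.reverse, fun h => h.reverse⟩

/-- An edge leaving a vertex goes closer to it in the opposite orientation, which is the one used
for sliding. -/
theorem isAdmissible_ofReversed_iff {p : ℕ} {O : EdgeOrientation} {m : ShadedMap E ι}
    {x : E ⊕ ι} {e : E} : (ofReversed O m x e).IsAdmissible p ↔
      m.IsHypermap p ∧ m.IsCloser (m.vertexAt x) e := by
  refine and_congr isHypermap_inOrientation_iff ?_
  have h : m.reverseVertex (m.reverse.vertexAt (m.light⁻¹ x)) = m.vertexAt x := by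
    rw [reverseVertex_vertexAt]
    congr 1
    exact m.light.apply_symm_apply x
  rw [← h, ← isLeaving_reverse_iff]
  cases O <;> rfl

variable [DecidableEq E] [DecidableEq ι]

theorem slide_ofReversed (O : EdgeOrientation) (m : ShadedMap E ι) (x : E ⊕ ι) (e : E) :
    (ofReversed O m x e).slide =
      ofSlide O m x e (m.lightestGeodesic (.inl e) (m.vertexAt x)) := by
  cases O
  · rfl
  · have : m.light (m.light⁻¹ x) = x := m.light.apply_symm_apply x
    change ofSlide .lightRight m (m.light (m.light⁻¹ x)) e
      (m.lightestGeodesic (.inl e) (m.vertexAt (m.light (m.light⁻¹ x)))) = _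
    rw [this]

theorem ofSlide_map_range (O : EdgeOrientation) (m : ShadedMap E ι) (x : E ⊕ ι) (e : E) (k : ℕ)
    (c : ℕ → E) : ofSlide O m x e ((List.range (k + 1)).map c) =
      ofReversed O.reverse (m.slid x (k + 1) c).reverse (m.slidReverseCorner x (k + 1) c)
        (c k) := by
  have hlast : ((List.range (k + 1)).map c).getLast? = some (c k) := by
    rw [List.range_succ]; simp
  rw [List.range_succ_eq_map, List.map_cons, List.map_map] at hlast ⊢
  have : (c 0 :: (List.range k).map (c ∘ Nat.succ)).getLast (List.cons_ne_nil _ _) = c k := by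
    rw [List.getLast?_eq_some_getLast (List.cons_ne_nil _ _)] at hlast
    exact Option.some.inj hlast
  rw [ofSlide, this, slitSlideSew_map_range, newCorner_map_range, mk_inOrientation]
  rfl

/-- Slit-slide-sew preserves admissible configurations and marks, and is its own inverse. -/
theorem exists_slide_ofReversed_eq [Finite E] [Finite ι] {p : ℕ} {m : ShadedMap E ι}
    {x : E ⊕ ι} {e : E} (hm : m.IsHypermap p) (he : m.IsCloser (m.vertexAt x) e) :
    ∃ (m' : ShadedMap E ι) (x' : E ⊕ ι) (e' : E), m'.IsHypermap p ∧
      m'.IsCloser (m'.vertexAt x') e' ∧ (m.IsMarked → m'.IsMarked) ∧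
      ∀ O, (ofReversed O m x e).slide = ofReversed O.reverse m' x' e' ∧
        (ofReversed O.reverse m' x' e').slide = ofReversed O m x e := by
  have hconn : m.IsStronglyConnected := IsConnected.isStronglyConnected hm.connected
  obtain ⟨k, c, rfl, hgeo, h⟩ := hconn.exists_isLightestSeq he
  have hsimple := h.isSimplePath
  rw [List.range_succ_eq_map, List.map_cons, List.map_map] at hsimple
  have hm' : (m.slid x (k + 1) c).IsHypermap p := by
    rw [← slitSlideSew_map_range]
    exact hm.slitSlideSew hsimple
  -- The distance estimates in the new map require its strong connectedness, so the hypermap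
  -- property has to come before them.
  have hconn' : (m.slid x (k + 1) c).IsStronglyConnected :=
    IsConnected.isStronglyConnected hm'.connected
  have hw : (m.slid x (k + 1) c).reverseVertex ((m.slid x (k + 1) c).reverse.vertexAt
      (m.slidReverseCorner x (k + 1) c)) = (m.slid x (k + 1) c).origin (c 0) := by
    rw [reverseVertex_vertexAt, ← h.slid_vertexAt_besideStart h.pos, ← h.slidCorner_eq]
    congr 1
    exact (m.slid x (k + 1) c).light.apply_symm_apply _
  have hlight := h.slid_reverse_isLightest hconn hconn' hw
  refine ⟨(m.slid x (k + 1) c).reverse, m.slidReverseCorner x (k + 1) c, c k, hm'.reverse, ?_,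
    fun hmark => ?_, fun O => ⟨?_, ?_⟩⟩
  · rw [isCloser_reverse_iff, hw, IsLeaving, h.slid_dist_origin hconn hconn' (Nat.lt_succ_self k),
      h.slid_dist_terminus hconn hconn' (Nat.lt_succ_self k)]
  · rw [← slitSlideSew_map_range]
    exact (hmark.slitSlideSew hsimple).reverse
  · rw [slide_ofReversed, hgeo, ofSlide_map_range]
  · have hcorner : (m.slid x (k + 1) c).reverse.slidReverseCorner
        (m.slidReverseCorner x (k + 1) c) (k + 1) (fun i => c (k + 1 - 1 - i)) = x := by
      rw [slidReverseCorner, h.slid_reverse_slid, h.slidCorner_slid_reverse]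
      exact m.light.apply_symm_apply x
    have hk : c (k + 1 - 1 - k) = c 0 := by simp
    rw [slide_ofReversed, show (Sum.inl (c k) : E ⊕ ι) = .inl (c (k + 1 - 1)) from rfl,
      hlight.lightestGeodesic_eq, ofSlide_map_range, h.slid_reverse_slid, hcorner, hk]
    cases O <;> rfl

theorem IsAdmissible.slide_spec [Finite E] [Finite ι] {p : ℕ} {q : Config E ι}
    (hq : q.IsAdmissible p) : q.slide.IsAdmissible p ∧ (q.map.IsMarked → q.slide.map.IsMarked) ∧
      q.slide.slide = q := by
  have hrev := ofReversed_inOrientation q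
  rw [← hrev, isAdmissible_ofReversed_iff] at hq
  obtain ⟨m', x', e', hm', he', hmark, hslide⟩ := exists_slide_ofReversed_eq hq.1 hq.2
  obtain ⟨h1, h2⟩ := hslide q.orient.reverse
  rw [hrev] at h1 h2
  rw [h1]
  refine ⟨isAdmissible_ofReversed_iff.2 ⟨hm', he'⟩, fun h => ?_, h2⟩
  exact isMarked_inOrientation_iff.2 (hmark (isMarked_inOrientation_iff.2 h))

end Config

/-! ### Passing to maps up to homeomorphism -/

/-- An involution of configurations satisfying `P` induces an involution of quadruples. -/
theorem exists_mapsTo_phi_involutive {r : ℕ} {P : ∀ {n : ℕ}, Config (Fin n) (Fin r) → Prop}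
    (hP : ∀ {n : ℕ} (a : Config (Fin n) (Fin r)), P a → P a.slide ∧ a.slide.slide = a)
    {S : Set (Quadruple r)} (hS : ∀ q, q ∈ S ↔ ∃ (n : ℕ) (a : Config (Fin n) (Fin r)),
      q = Quotient.mk (configSetoid r) ⟨n, a⟩ ∧ P a) :
    ∃ h : Set.MapsTo (Phi (r := r)) S S, Function.Involutive (h.restrict Phi S S) := by
  have h : Set.MapsTo (Phi (r := r)) S S := by
    intro q hq
    obtain ⟨n, a, rfl, ha⟩ := (hS q).1 hq
    exact (hS _).2 ⟨n, a.slide, rfl, (hP a ha).1⟩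
  refine ⟨h, fun ⟨q, hq⟩ => Subtype.ext ?_⟩
  obtain ⟨n, a, rfl, ha⟩ := (hS q).1 hq
  change Quotient.mk (configSetoid r) ⟨n, a.slide.slide⟩ = _
  rw [(hP a ha).2]

end Hyper

end

theorem theorem1 (p : ℕ) (hp : 2 ≤ p) :
    (∃ h : Set.MapsTo Hyper.Phi (Hyper.H p) (Hyper.H p),
      Function.Involutive (h.restrict Hyper.Phi (Hyper.H p) (Hyper.H p))) ∧
    ∀ r : ℕ, ∃ h : Set.MapsTo Hyper.Phi (Hyper.markedH p r) (Hyper.markedH p r),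
      Function.Involutive (h.restrict Hyper.Phi (Hyper.markedH p r) (Hyper.markedH p r)) := by
  refine ⟨Hyper.exists_mapsTo_phi_involutive (P := fun a => a.IsAdmissible p)
    (fun a ha => ⟨ha.slide_spec.1, ha.slide_spec.2.2⟩) fun q => Iff.rfl, fun r =>
    Hyper.exists_mapsTo_phi_involutive (P := fun a => a.IsAdmissible p ∧ a.map.IsMarked)
      (fun a ha => ⟨⟨ha.1.slide_spec.1, ha.1.slide_spec.2.1 ha.2⟩, ha.1.slide_spec.2.2⟩)
      fun q => Iff.rfl⟩
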